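/- Let $q$ be a prime power, let $t, n_1,\dots,n_t, m_1,\dots,m_t$ be positive integers with $m_1\ge\dots\ge m_t$ and $m_i\ge n_i$ for all $i\in[t]=\{1,\dots,t\}$, and put $n=n_1+\dots+n_t$ and $\mathbb M=\mathbb F_q^{m_1\times n_1}\times\dots\times\mathbb F_q^{m_t\times n_t}$. A code is an $\mathbb F_q$-linear subspace of $\mathbb M$. For $C=(C_1,\dots,C_t)\in\mathbb M$ let $\mathrm{srk}(C)=\sum_i \mathrm{rk}(C_i)$. For a code $\mathcal C$ let $\mathrm{maxsrk}(\mathcal C)=\max\{\mathrm{srk}(C):C\in\mathcal C\}$ and, if $\mathcal C\ne0$, let $d(\mathcal C)=\min\{\mathrm{srk}(C):0\ne C\in\mathcal C\}$. A subspace $\mathcal A_i\subseteq\mathbb F_q^{m_i\times n_i}$ is an optimal anticode if $\dim\mathcal A_i=m_i\cdot\max\{\mathrm{rk}(A):A\in\mathcal A_i\}$. The weight $\mathrm{wt}(\mathcal C)$ of a code is the minimum of $\mathrm{maxsrk}(\mathcal A)$ over all products $\mathcal A=\mathcal A_1\times\dots\times\mathcal A_t\supseteq\mathcal C$ of optimal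 anticodes $\mathcal A_i\subseteq\mathbb F_q^{m_i\times n_i}$. For $1\le r\le\dim\mathcal C$, the $r$-th generalized sum-rank weight is $d_r(\mathcal C)=\min\{\mathrm{wt}(\mathcal D):\mathcal D\subseteq\mathcal C,\ \dim\mathcal D\ge r\}$. A code $\mathcal C$ is MSRD if there are $j\in[t]$ and $0\le\delta\le n_j-1$ with $d(\mathcal C)=\sum_{i=1}^{j-1}n_i+\delta+1$ and $\dim\mathcal C=\sum_{i=j}^t m_in_i-\delta m_j$. A $k$-dimensional code $\mathcal C$ satisfies the chain condition if there are subcodes $0\subsetneq\mathcal D_1\subsetneq\dots\subsetneq\mathcal D_k=\mathcal C$ with $\mathrm{wt}(\mathcal D_r)=d_r(\mathcal C)$ for all $r\in[k]$. A greedy $1$-subcode of $\mathcal C$ is a $1$-dimensional subcode of weight $d_1(\mathcal C)$; for $2\le r\le k$ a greedy $r$-subcode is an $r$-dimensional subcode of $\mathcal C$ of minimum weight among those that contain a greedy $(r-1)$-subcode. The $r$-th greedy weight of $\mathcal C$ is the weight of any greedy $r$-subcode. Theorem. Assume that there is a chain of MSRD codes $\mathbb M=\mathcal D_1\supseteq\mathcal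 D_2\supseteq\dots\supseteq\mathcal D_n$ with $d(\mathcal D_h)=h$ for all $h\in[n]$. 1. A sequence of positive integers $d_1,\dots,d_k$ is the sequence of generalized sum-rank weights $d_1(\mathcal C),\dots,d_k(\mathcal C)$ of a $k$-dimensional code $\mathcal C\subseteq\mathbb M$ if and only if it is a non-decreasing sequence in $[n]$ in which the integer $n_1+\dots+n_{i-1}+j$ appears at most $m_i$ times, for all $i\in[t]$ and $j\in[n_i]$. 2. For every such sequence the code $\mathcal C$ can be chosen so that, in addition, it satisfies the chain condition and $d_1,\dots,d_k$ is also its sequence of greedy weights. 3. In particular, every subsequence of the sequence of generalized sum-rank weights of $\mathbb M$ is the sequence of greedy weights of a code $\mathcal C\subseteq\mathbb M$. -/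

import Mathlib

namespace SumRank

/-- The ambient space `F^{m_1 × n_1} × ⋯ × F^{m_t × n_t}`. A (linear) sum-rank metric code is an
`F`-subspace of it. -/
abbrev Ambient (F : Type*) [Field F] {t : ℕ} (m n : Fin t → ℕ) : Type _ :=
  ∀ i : Fin t, Matrix (Fin (m i)) (Fin (n i)) F

section Codes

variable {F : Type*} [Field F] {t : ℕ} {m n : Fin t → ℕ}

/-- Sum-rank weight of an element. -/
noncomputable def srk (X : Ambient F m n) : ℕ := ∑ i, (X i).rank

/-- Minimum distance of a nonzero code (the value on the zero code is the junk value `0`). -/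
noncomputable def minDist (C : Submodule F (Ambient F m n)) : ℕ :=
  sInf {w | ∃ X ∈ C, X ≠ 0 ∧ srk X = w}

/-- Maximum sum-rank distance of a code; the set is nonempty and bounded by `n_1 + ⋯ + n_t`. -/
noncomputable def maxSrk (C : Submodule F (Ambient F m n)) : ℕ :=
  sSup {w | ∃ X ∈ C, srk X = w}

/-- Optimal anticodes in a single matrix space `F^{a × b}` (used for `b ≤ a`): the codes that
attain the bound `dim A ≤ max {a * rk X : X ∈ A}`. -/
def IsOptimalAnticode {a b : ℕ} (A : Submodule F (Matrix (Fin a) (Fin b) F)) : Prop :=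
  Module.finrank F A = sSup {w | ∃ X ∈ A, a * X.rank = w}

/-- Weight of a code: the least maximum sum-rank distance of a product of optimal anticodes
that contains it. -/
noncomputable def wt (C : Submodule F (Ambient F m n)) : ℕ :=
  sInf {w | ∃ A : ∀ i : Fin t, Submodule F (Matrix (Fin (m i)) (Fin (n i)) F),
    (∀ i, IsOptimalAnticode (A i)) ∧ C ≤ Submodule.pi Set.univ A ∧
      maxSrk (Submodule.pi Set.univ A) = w}

/-- `r`-th generalized sum-rank weight, for `1 ≤ r ≤ dim C`. -/
noncomputable def genWeight (C : Submodule F (Ambient F m n)) (r : ℕ) : ℕ :=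
  sInf {w | ∃ D ≤ C, r ≤ Module.finrank F D ∧ wt D = w}

/-- `d 0, …, d (k-1)` is the sequence of generalized weights `d_1(C), …, d_k(C)`, `k = dim C`. -/
def IsGenWeightSeq (C : Submodule F (Ambient F m n)) {k : ℕ} (d : Fin k → ℕ) : Prop :=
  Module.finrank F C = k ∧ ∀ r : Fin k, genWeight C (r + 1) = d r

/-- Maximum sum-rank distance (MSRD) codes. -/
def IsMSRD (C : Submodule F (Ambient F m n)) : Prop :=
  ∃ j : Fin t, ∃ δ < n j, minDist C = ∑ i ∈ Finset.Iio j, n i + δ + 1 ∧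
    Module.finrank F C + δ * m j = ∑ i ∈ Finset.Ici j, m i * n i

/-- `IsGreedySubcode C r D`: `D` is a greedy `r`-subcode of `C`, for `1 ≤ r ≤ dim C`
(the case `r = 0` is a convention that the other cases do not use). -/
def IsGreedySubcode (C : Submodule F (Ambient F m n)) :
    ℕ → Submodule F (Ambient F m n) → Prop
  | 0, D => D = ⊥
  | 1, D => D ≤ C ∧ Module.finrank F D = 1 ∧ wt D = genWeight C 1
  | r + 2, D =>
      (D ≤ C ∧ Module.finrank F D = r + 2 ∧ ∃ E ≤ D, IsGreedySubcode C (r + 1) E) ∧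
      ∀ D' : Submodule F (Ambient F m n),
        (D' ≤ C ∧ Module.finrank F D' = r + 2 ∧ ∃ E ≤ D', IsGreedySubcode C (r + 1) E) →
          wt D ≤ wt D'

/-- `r`-th greedy weight: the common weight of all greedy `r`-subcodes. -/
noncomputable def greedyWeight (C : Submodule F (Ambient F m n)) (r : ℕ) : ℕ :=
  sInf {w | ∃ D, IsGreedySubcode C r D ∧ wt D = w}

/-- `d 0, …, d (k-1)` is the sequence of greedy weights `g_1(C), …, g_k(C)`, `k = dim C`. -/
def IsGreedyWeightSeq (C : Submodule F (Ambient F m n)) {k : ℕ} (d : Fin k → ℕ) : Prop :=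
  Module.finrank F C = k ∧ ∀ r : Fin k, greedyWeight C (r + 1) = d r

/-- Chain condition: there is a chain `0 = D_0 ⊊ D_1 ⊊ ⋯ ⊊ D_k = C`, `k = dim C`, with
`d_r(C) = wt(D_r)` for `1 ≤ r ≤ k`. -/
def ChainCondition (C : Submodule F (Ambient F m n)) : Prop :=
  ∃ D : ℕ → Submodule F (Ambient F m n),
    D 0 = ⊥ ∧ D (Module.finrank F C) = C ∧
    (∀ r < Module.finrank F C, D r < D (r + 1)) ∧
    ∀ r ∈ Finset.Icc 1 (Module.finrank F C), genWeight C r = wt (D r)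

end Codes

/-- The sequence `d` is non-decreasing with values in `[n_1 + ⋯ + n_t]`, and the integer
`n_1 + ⋯ + n_{i-1} + j` appears in it at most `m_i` times for all `i ∈ [t]`, `j ∈ [n_i]`. -/
def IsAdmissible {t : ℕ} (m n : Fin t → ℕ) {k : ℕ} (d : Fin k → ℕ) : Prop :=
  Monotone d ∧ (∀ r, d r ∈ Finset.Icc 1 (∑ i, n i)) ∧
    ∀ i : Fin t, ∀ j ∈ Finset.Icc 1 (n i),
      (Finset.univ.filter fun r : Fin k => d r = ∑ l ∈ Finset.Iio i, n l + j).card ≤ m i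

end SumRank

/-! Necessity. Let D have weight n_1+…+n_{i-1}+j with j ≥ 1, and let it lie in a product of optimal
anticodes of ranks r_l with sum wt(D). The blocks before i contribute at most n_1+…+n_{i-1}, so r_l
> 0 for some l ≥ i. At most m_l ≤ m_i linear conditions on D lower r_l by one (`exists_wt_lt`). If a
generalized weight occurred more than m_i times, the subcode so obtained would be too light for its
dimension.

Lowering a rank needs the structure of optimal anticodes over a finite field
(`exists_annihilated_or_range_le`): either all matrices vanish on a common subspace, or they are
square and all images lie in a common subspace. For the proof fix a basis of the source, and let the
j-th leading space consist of the values at the j-th basis vector of the maps that kill the earlier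
ones. The dimensions of the leading spaces add up to that of the anticode. An independent
transversal of them can be realised by one map of the anticode, so it has at most a members, a being
the rank bound. By counting, the leading spaces are each zero or full, or the matrices are square
and all leading spaces have dimension a.

Sufficiency (`IsAdmissible.exists_code`). Let p = n_1+…+n_{i-1}+j. By dimensions, the tuples
supported on the first p columns meet the MSRD code of distance p in dimension at least m_i, so
independent vectors can be picked there, as many as p occurs in the sequence. Their span C has the
required weights: supports bound the weights of initial spans from above, distances bound the
weights of all subcodes from below. The initial spans form the chain, and with the chain condition
greedy and generalized weights agree. -/

namespace SumRank

open Module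

/-! ### Leading spaces and independent transversals -/

section BoundedRank

variable {F V W : Type*} [Field F] [AddCommGroup V] [Module F V] [AddCommGroup W] [Module F W]

/-- The maps in `A` that vanish on the first `k` members of the family `b`. -/
def vanishing {n : ℕ} (A : Submodule F (V →ₗ[F] W)) (b : Fin n → V) (k : ℕ) :
    Submodule F (V →ₗ[F] W) where
  carrier := {X | X ∈ A ∧ ∀ i : Fin n, (i : ℕ) < k → X (b i) = 0}
  add_mem' := fun hX hY => ⟨A.add_mem hX.1 hY.1, fun i hi => by simp [hX.2 i hi, hY.2 i hi]⟩
  zero_mem' := ⟨A.zero_mem, fun i _ => rfl⟩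
  smul_mem' := fun c X hX => ⟨A.smul_mem c hX.1, fun i hi => by simp [hX.2 i hi]⟩

/-- The values at `b j` of the maps in `A` that vanish at all earlier members of `b`. -/
def lead {n : ℕ} (A : Submodule F (V →ₗ[F] W)) (b : Fin n → V) (j : Fin n) : Submodule F W :=
  (vanishing A b j).map (LinearMap.applyₗ (b j))

theorem mem_lead {n : ℕ} {A : Submodule F (V →ₗ[F] W)} {b : Fin n → V} {j : Fin n} {w : W} :
    w ∈ lead A b j ↔ ∃ X ∈ A, (∀ i < j, X (b i) = 0) ∧ X (b j) = w := by
  simp only [lead, Submodule.mem_map, vanishing]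
  constructor
  · rintro ⟨X, ⟨h1, h2⟩, h3⟩
    exact ⟨X, h1, fun i hi => h2 i hi, h3⟩
  · rintro ⟨X, h1, h2, h3⟩
    exact ⟨X, ⟨h1, fun i hi => h2 i hi⟩, h3⟩

theorem finrank_map_add_finrank_inf_ker [FiniteDimensional F V] (f : V →ₗ[F] W)
    (p : Submodule F V) :
    finrank F (p.map f) + finrank F (p ⊓ LinearMap.ker f : Submodule F V) = finrank F p := by
  have h := LinearMap.finrank_range_add_finrank_ker (f.domRestrict p)
  rw [LinearMap.range_domRestrict, LinearMap.ker_domRestrict] at h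
  rw [← h]
  congr 1
  have e := (Submodule.equivSubtypeMap p ((LinearMap.ker f).comap p.subtype)).finrank_eq
  rw [Submodule.map_comap_subtype] at e
  exact e.symm

/-- Changing one column at a time, an independent family of leading values can be turned into
the values of a single map of `A`. -/
theorem exists_linearIndepOn_apply {n : ℕ} {A : Submodule F (V →ₗ[F] W)} (b : Fin n → V)
    (J : Finset (Fin n)) (Z : Fin n → V →ₗ[F] W) (hZ : ∀ l, Z l ∈ A)
    (hz : ∀ l, ∀ i < l, Z l (b i) = 0) (k : ℕ) (hk : k ≤ n) (Y : V →ₗ[F] W) (hY : Y ∈ A)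
    (h : LinearIndepOn F (fun l : Fin n => if (l : ℕ) < k then Y (b l) else Z l (b l)) J) :
    ∃ X ∈ A, LinearIndepOn F (fun l => X (b l)) J := by
  -- Passing from `k` to `k + 1` replaces `Y` by `Y + c • Z j` with `j = k`. Values before `j` do
  -- not change, because `Z j` vanishes there.
  induction hk using Nat.decreasingInduction generalizing Y with
  | self => exact ⟨Y, hY, h.congr fun l _ => by simp⟩
  | of_succ k hk ih =>
    let j : Fin n := ⟨k, hk⟩
    have key : ∀ c : F, ∀ l : Fin n, l ≠ j →
        (if (l : ℕ) < k then Y (b l) else Z l (b l)) =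
        (if (l : ℕ) < k + 1 then (Y + c • Z j) (b l) else Z l (b l)) := by
      intro c l hl
      have hl' : (l : ℕ) ≠ k := fun h => hl (Fin.ext h)
      by_cases hlk : (l : ℕ) < k
      · have : Z j (b l) = 0 := hz j l hlk
        simp [hlk, Nat.lt_succ_of_lt hlk, this]
      · have : ¬ (l : ℕ) < k + 1 := by omega
        simp [hlk, this]
    by_cases hj : j ∈ J
    · have hins : insert j ((J : Set (Fin n)) \ {j}) = J := by
        simp [hj]
      rw [← hins, linearIndepOn_insert (by simp)] at h
      obtain ⟨h1, h2⟩ := h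
      -- One of `c = 0`, `c = 1` works: otherwise the difference `Z j (b j)` of the two values would
      -- lie in the span, against `h2`.
      have hc : ∃ c : F, (Y + c • Z j) (b j) ∉ Submodule.span F
          ((fun l : Fin n => if (l : ℕ) < k then Y (b l) else Z l (b l)) ''
            ((J : Set (Fin n)) \ {j})) := by
        by_contra hcon
        push Not at hcon
        apply h2
        have h0 := hcon 0
        have h1 := hcon 1
        have := Submodule.sub_mem _ h1 h0
        simpa [j] using this
      obtain ⟨c, hc⟩ := hc
      refine ih (Y + c • Z j) (A.add_mem hY (A.smul_mem c (hZ j))) ?_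
      rw [← hins, linearIndepOn_insert (by simp)]
      have heq : Set.EqOn (fun l : Fin n => if (l : ℕ) < k then Y (b l) else Z l (b l))
        (fun l : Fin n => if (l : ℕ) < k + 1 then (Y + c • Z j) (b l) else Z l (b l))
        ((J : Set (Fin n)) \ {j}) := fun l hl => key c l (by simpa using hl.2)
      refine ⟨h1.congr heq, ?_⟩
      rw [← heq.image_eq]
      simpa [j] using hc
    · refine ih Y hY (h.congr fun l hl => ?_)
      have := key 0 l (fun h => hj (h ▸ hl))
      simpa using this

theorem card_le_finrank_range_of_linearIndepOn [FiniteDimensional F W] {n : ℕ} {X : V →ₗ[F] W}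
    {b : Fin n → V} {J : Finset (Fin n)} (h : LinearIndepOn F (fun l => X (b l)) J) :
    J.card ≤ finrank F (LinearMap.range X) := by
  have h' : LinearIndependent F (fun l : J => (⟨X (b l), X.mem_range_self _⟩ :
      LinearMap.range X)) :=
    LinearIndependent.of_comp (LinearMap.range X).subtype h
  simpa using h'.fintype_card_le_finrank

/-- An independent family that consists of values of one map of `A` on an initial segment and of
leading values after it has at most as many members as the largest rank in `A`. -/
theorem card_le_of_linearIndepOn_lead [FiniteDimensional F W] {n a : ℕ}
    {A : Submodule F (V →ₗ[F] W)} (hA : ∀ X ∈ A, finrank F (LinearMap.range X) ≤ a)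
    (b : Fin n → V) (J : Finset (Fin n)) (w : Fin n → W) (k : ℕ) (hk : k ≤ n)
    {Y : V →ₗ[F] W} (hY : Y ∈ A) (hw : ∀ j ∈ J, (j : ℕ) < k → w j = Y (b j))
    (hw' : ∀ j ∈ J, k ≤ j → w j ∈ lead A b j) (h : LinearIndepOn F w J) : J.card ≤ a := by
  have hex : ∀ j : Fin n, ∃ X ∈ A, (∀ i < j, X (b i) = 0) ∧ (j ∈ J → k ≤ j → X (b j) = w j) := by
    intro j
    by_cases hj : j ∈ J ∧ k ≤ j
    · obtain ⟨X, h1, h2, h3⟩ := mem_lead.1 (hw' j hj.1 hj.2)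
      exact ⟨X, h1, h2, fun _ _ => h3⟩
    · exact ⟨0, A.zero_mem, fun _ _ => rfl, fun h1 h2 => absurd ⟨h1, h2⟩ hj⟩
  choose Z hZ hz hzw using hex
  obtain ⟨X, hX, hX'⟩ := exists_linearIndepOn_apply b J Z hZ hz k hk Y hY
    (h.congr (w := fun l : Fin n => if (l : ℕ) < k then Y (b l) else Z l (b l)) fun j hj => by
      by_cases hjk : (j : ℕ) < k
      · simp [hjk, hw j hj hjk]
      · simp [hjk, hzw j hj (not_lt.1 hjk)])
  exact (card_le_finrank_range_of_linearIndepOn hX').trans (hA X hX)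

/-- The spaces `vanishing A b k` filter `A` with successive quotients the leading spaces; the last
one is zero because `b` spans. -/
theorem sum_finrank_lead [FiniteDimensional F V] [FiniteDimensional F W] {n : ℕ}
    (A : Submodule F (V →ₗ[F] W)) {b : Fin n → V} (hb : Submodule.span F (Set.range b) = ⊤) :
    ∑ j, finrank F (lead A b j) = finrank F A := by
  have step : ∀ k, (hk : k < n) → finrank F (vanishing A b k) =
      finrank F (lead A b ⟨k, hk⟩) + finrank F (vanishing A b (k + 1)) := by
    intro k hk
    rw [← finrank_map_add_finrank_inf_ker (LinearMap.applyₗ (b ⟨k, hk⟩)) (vanishing A b k)]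
    have : vanishing A b k ⊓ LinearMap.ker (LinearMap.applyₗ (b ⟨k, hk⟩)) =
        vanishing A b (k + 1) := by
      ext X
      simp only [Submodule.mem_inf, LinearMap.mem_ker, LinearMap.applyₗ_apply_apply]
      constructor
      · rintro ⟨⟨h1, h2⟩, h3⟩
        refine ⟨h1, fun i hi => ?_⟩
        rcases Nat.lt_succ_iff_lt_or_eq.1 hi with h | h
        · exact h2 i h
        · rw [← h3]; congr 2; exact Fin.ext h
      · rintro ⟨h1, h2⟩
        exact ⟨⟨h1, fun i hi => h2 i (by omega)⟩, h2 _ (by simp)⟩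
    rw [this, lead]
  have tel : ∀ k ≤ n, finrank F A = ∑ j ∈ Finset.univ.filter (fun j : Fin n => (j : ℕ) < k),
      finrank F (lead A b j) + finrank F (vanishing A b k) := by
    intro k
    induction k with
    | zero =>
      intro _
      have : vanishing A b 0 = A := by ext X; simp [vanishing]
      rw [this]
      simp
    | succ k ih =>
      intro hk
      rw [ih (by omega), step k hk]
      have : Finset.univ.filter (fun j : Fin n => (j : ℕ) < k + 1) =
          insert ⟨k, hk⟩ (Finset.univ.filter (fun j : Fin n => (j : ℕ) < k)) := by
        ext j; simp [Fin.ext_iff]; omega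
      rw [this, Finset.sum_insert (by simp)]
      omega
  have h0 : vanishing A b n = ⊥ := by
    rw [eq_bot_iff]
    rintro X ⟨-, h⟩
    rw [Submodule.mem_bot]
    apply LinearMap.ext_on hb
    rintro _ ⟨i, rfl⟩
    simpa using h i i.2
  rw [tel n le_rfl, h0]
  simp

/-- Greedy choice of an independent transversal that extends a given independent family. -/
theorem exists_linearIndepOn_transversal [FiniteDimensional F W] {ι : Type*} [DecidableEq ι]
    (S : ι → Submodule F W) (J₀ : Finset ι) (w₀ : ι → W) (h₀ : LinearIndepOn F w₀ J₀) (r : ℕ)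
    (T : Finset ι) (hT : Disjoint J₀ T)
    (h : ∀ i < r, r ≤ i + (T.filter fun j => J₀.card + i < finrank F (S j)).card) :
    ∃ J ⊆ T, J.card = r ∧ ∃ w : ι → W, (∀ j ∈ J₀, w j = w₀ j) ∧ (∀ j ∈ J, w j ∈ S j) ∧
      LinearIndepOn F w (J₀ ∪ J : Finset ι) := by
  induction r generalizing T with
  | zero => exact ⟨∅, by simp, rfl, w₀, fun _ _ => rfl, by simp, by simpa using h₀⟩
  | succ r ih =>
    -- A space of dimension larger than `J₀.card + r` is set aside and served last: the vectors
    -- chosen before it cannot span it.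
    have hne : 0 < (T.filter fun j => J₀.card + r < finrank F (S j)).card := by
      have := h r (by omega); omega
    obtain ⟨j, hj⟩ := Finset.card_pos.1 hne
    rw [Finset.mem_filter] at hj
    obtain ⟨J, hJT, hJr, w, hw₀, hw, hli⟩ := ih (T.erase j)
      (hT.mono_right (Finset.erase_subset _ _)) (by
        intro i hi
        have h1 := h i (by omega)
        have h2 : ((T.erase j).filter fun l => J₀.card + i < finrank F (S l)) =
          (T.filter fun l => J₀.card + i < finrank F (S l)).erase j := by
          ext l; simp; tauto
        rw [h2, Finset.card_erase_of_mem (by simp [hj.1]; omega)]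
        omega)
    have hjJ₀ : j ∉ J₀ := fun h' => Finset.disjoint_left.1 hT h' hj.1
    have hjJ : j ∉ J := fun h' => Finset.notMem_erase j T (hJT h')
    have hcard : (J₀ ∪ J).card = J₀.card + r := by
      rw [Finset.card_union_of_disjoint (hT.mono_right (hJT.trans (Finset.erase_subset _ _))), hJr]
    have hex : ∃ x ∈ S j, x ∉ Submodule.span F (w '' (J₀ ∪ J : Finset ι)) := by
      by_contra hcon
      push Not at hcon
      have h1 := Submodule.finrank_mono (show S j ≤ _ from hcon)
      have h2 : finrank F (Submodule.span F (w '' (J₀ ∪ J : Finset ι))) ≤ (J₀ ∪ J).card := by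
        classical
        rw [← Finset.coe_image]
        exact (finrank_span_finset_le_card _).trans Finset.card_image_le
      omega
    obtain ⟨x, hxS, hx⟩ := hex
    have heq : Set.EqOn w (Function.update w j x) (J₀ ∪ J : Finset ι) := by
      intro l hl
      have : l ≠ j := by
        rintro rfl
        simp [hjJ₀, hjJ] at hl
      simp [this]
    refine ⟨insert j J, ?_, by simp [hjJ, hJr], Function.update w j x, ?_, ?_, ?_⟩
    · exact Finset.insert_subset hj.1 (hJT.trans (Finset.erase_subset _ _))
    · intro l hl
      rw [← heq (by simp [hl]), hw₀ l hl]
    · intro l hl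
      rcases Finset.mem_insert.1 hl with rfl | hl
      · simpa using hxS
      · rw [← heq (by simp [hl])]; exact hw l hl
    · rw [Finset.union_insert, Finset.coe_insert, linearIndepOn_insert (by simp [hjJ₀, hjJ])]
      refine ⟨hli.congr heq, ?_⟩
      rw [← heq.image_eq]
      simpa using hx

/-- Extremal sequences of dimensions without a long independent transversal. -/
theorem eq_zero_or_eq_of_sum_eq {m n a : ℕ} (hnm : n ≤ m) (han : a ≤ n) (s : Fin n → ℕ)
    (hs : ∀ j, s j ≤ m) (hsum : ∑ j, s j = m * a)
    (h : ∃ i ≤ a, i + (Finset.univ.filter fun j => i < s j).card ≤ a) :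
    (∀ j, s j = 0 ∨ s j = m) ∨ (m = n ∧ ∀ j, s j = a) := by
  obtain ⟨i, hia, hi⟩ := h
  set N := (Finset.univ.filter fun j => i < s j).card with hN
  have hb : ∑ j, (if i < s j then m else i) = N * m + (n - N) * i := by
    rw [Finset.sum_ite, Finset.sum_const, Finset.sum_const, smul_eq_mul, smul_eq_mul, ← hN]
    congr 2
    have := Finset.card_filter_add_card_filter_not (s := (Finset.univ : Finset (Fin n)))
      (fun j => i < s j)
    simp only [Finset.card_univ, Fintype.card_fin] at this
    omega
  have hle : ∀ j ∈ Finset.univ, s j ≤ if i < s j then m else i := by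
    intro j _
    split_ifs with hj
    · exact hs j
    · omega
  have hNn : N ≤ n := by omega
  have hle' := Finset.sum_le_sum hle
  rw [hb, hsum] at hle'
  obtain ⟨c, hc⟩ := Nat.exists_eq_add_of_le hnm
  obtain ⟨e, he⟩ := Nat.exists_eq_add_of_le hi
  obtain ⟨f, hf⟩ := Nat.exists_eq_add_of_le han
  have hsub : n - N = i + e + f := by omega
  rw [hsub] at hb hle'
  -- With the slacks `c = m - n`, `e = a - i - N`, `f = n - a`, this is exactly the excess of the
  -- prescribed sum `m * a` over the upper bound `N * m + (n - N) * i`. So everything is an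
  -- equality.
  have hz : i * (N + c) + e * m ≤ 0 := by
    have h1 : m * a = N * m + m * (i + e) := by rw [he]; ring
    have h2 : m * (i + e) = (i + e + f) * i + i * (N + c) + e * m := by
      have : m = i + N + e + f + c := by omega
      rw [this]; ring
    omega
  have hiN : i * (N + c) = 0 := by omega
  have hem : e * m = 0 := by omega
  have he0 : e = 0 := by
    rcases Nat.mul_eq_zero.1 hem with h | h <;> omega
  have heq : ∀ j ∈ Finset.univ, s j = if i < s j then m else i := by
    rw [← Finset.sum_eq_sum_iff_of_le hle, hb, hsum]
    apply le_antisymm hle'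
    have h1 : m * a = N * m + m * (i + e) := by rw [he]; ring
    have h2 : m * (i + e) = (i + e + f) * i + i * (N + c) + e * m := by
      have : m = i + N + e + f + c := by omega
      rw [this]; ring
    omega
  rcases Nat.mul_eq_zero.1 hiN with hi0 | hi0
  · left
    intro j
    have := heq j (Finset.mem_univ _)
    split_ifs at this with hj
    · exact Or.inr this
    · exact Or.inl (this.trans hi0)
  · right
    refine ⟨by omega, fun j => ?_⟩
    have hj : ¬ i < s j := by
      have : (Finset.univ.filter fun j => i < s j) = ∅ := Finset.card_eq_zero.1 (by omega)
      simpa using (Finset.eq_empty_iff_forall_notMem.1 this) j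
    have := heq j (Finset.mem_univ _)
    rw [if_neg hj] at this
    omega

end BoundedRank

end SumRank

/-! ### Classification of extremal spaces of maps of bounded rank -/

namespace SumRank

open Module

section BoundedRank

variable {F V W : Type*} [Field F] [AddCommGroup V] [Module F V] [AddCommGroup W] [Module F W]

theorem exists_extend_linearIndependent [FiniteDimensional F V] {e n : ℕ} (he : e ≤ n)
    (hn : n ≤ finrank F V) (u : Fin e → V) (hu : LinearIndependent F u) :
    ∃ b : Fin n → V, LinearIndependent F b ∧ ∀ i : Fin e, b (Fin.castLE he i) = u i := by
  induction n, he using Nat.le_induction with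
  | base => exact ⟨u, hu, fun i => rfl⟩
  | succ n he ih =>
    obtain ⟨b, hb, hbu⟩ := ih (by omega)
    obtain ⟨x, hx⟩ := exists_linearIndependent_snoc_of_lt_finrank hb (by omega)
    refine ⟨_, hx, fun i => ?_⟩
    rw [← hbu i]
    exact Fin.snoc_castSucc (α := fun _ => V) x b (Fin.castLE he i)

/-- Supplies the one extra vector that makes a transversal of size `a` too long: `S` is a space of
values, `T` the span of the transversal. -/
theorem exists_mem_notMem_of_finrank_le {S T : Submodule F W} [FiniteDimensional F W]
    (h : finrank F T ≤ finrank F S) {x : W} (hx : x ∈ T) (hx' : x ∉ S) : ∃ y ∈ S, y ∉ T := by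
  by_contra hcon
  push Not at hcon
  exact hx' (Submodule.eq_of_le_of_finrank_le (show S ≤ T from hcon) h ▸ hx)

theorem finrank_span_image_finset_le [FiniteDimensional F W] {ι : Type*} (w : ι → W)
    (J : Finset ι) : finrank F (Submodule.span F (w '' (J : Set ι))) ≤ J.card := by
  classical
  rw [← Finset.coe_image]
  exact (finrank_span_finset_le_card _).trans Finset.card_image_le

/-- The space of values of `A` at a vector. -/
abbrev valuesAt (A : Submodule F (V →ₗ[F] W)) (v : V) : Submodule F W :=
  A.map (LinearMap.applyₗ v)

theorem mem_valuesAt {A : Submodule F (V →ₗ[F] W)} {v : V} {w : W} :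
    w ∈ valuesAt A v ↔ ∃ X ∈ A, X v = w := by
  simp [valuesAt]

theorem lead_eq_valuesAt {n : ℕ} (A : Submodule F (V →ₗ[F] W)) (b : Fin n → V) (j : Fin n)
    (hj : (j : ℕ) = 0) : lead A b j = valuesAt A (b j) := by
  ext w
  rw [mem_lead, mem_valuesAt]
  constructor
  · rintro ⟨X, h1, -, h3⟩
    exact ⟨X, h1, h3⟩
  · rintro ⟨X, h1, h3⟩
    exact ⟨X, h1, fun i hi => absurd (Fin.lt_def.1 hi) (by omega), h3⟩

variable [FiniteDimensional F V] [FiniteDimensional F W]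

/-- The possible dimensions of the spaces of leading values in an extremal space of maps of
bounded rank. -/
theorem finrank_lead_of_extremal {a : ℕ} (hVW : finrank F V ≤ finrank F W)
    (haV : a ≤ finrank F V) {A : Submodule F (V →ₗ[F] W)}
    (hA : ∀ X ∈ A, finrank F (LinearMap.range X) ≤ a) (hdim : finrank F A = finrank F W * a)
    {b : Fin (finrank F V) → V} (hb : LinearIndependent F b) :
    (∀ j, finrank F (lead A b j) = 0 ∨ finrank F (lead A b j) = finrank F W) ∨
      (finrank F W = finrank F V ∧ ∀ j, finrank F (lead A b j) = a) := by
  have hspan : Submodule.span F (Set.range b) = ⊤ :=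
    hb.span_eq_top_of_card_eq_finrank' (by simp)
  refine eq_zero_or_eq_of_sum_eq hVW haV _ (fun j => Submodule.finrank_le _)
    ((sum_finrank_lead A hspan).trans hdim) ?_
  by_contra hcon
  push Not at hcon
  -- If the counting condition fails for every `i ≤ a`, the greedy choice yields a transversal with
  -- `a + 1` members.
  obtain ⟨J, -, hJ, w, -, hw, hli⟩ := exists_linearIndepOn_transversal (lead A b) ∅ 0
    (by simp) (a + 1) Finset.univ (by simp) (fun i hi => by
      have := hcon i (by omega)
      simpa using this)
  have := card_le_of_linearIndepOn_lead hA b J w 0 (Nat.zero_le _) A.zero_mem (by simp)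
    (fun j hj _ => hw j hj) (by simpa using hli)
  omega

/-- If every space of values is zero or full, then a large subspace is annihilated. -/
theorem exists_annihilated_of_valuesAt [Finite F] {a : ℕ} (hVW : finrank F V ≤ finrank F W)
    {A : Submodule F (V →ₗ[F] W)}
    (hA : ∀ X ∈ A, finrank F (LinearMap.range X) ≤ a) (hdim : finrank F A = finrank F W * a)
    (h : ∀ v, finrank F (valuesAt A v) = 0 ∨ finrank F (valuesAt A v) = finrank F W) :
    ∃ U : Submodule F V, finrank F V ≤ finrank F U + a ∧ ∀ X ∈ A, ∀ v ∈ U, X v = 0 := by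
  classical
  let U : Submodule F V := ⨅ X ∈ A, LinearMap.ker X
  have hU : ∀ v, v ∈ U ↔ ∀ X ∈ A, X v = 0 := by simp [U]
  refine ⟨U, ?_, fun X hX v hv => (hU v).1 hv X hX⟩
  rcases Nat.eq_zero_or_pos a with rfl | ha
  · rw [mul_zero, Submodule.finrank_eq_zero] at hdim
    subst hdim
    have : U = ⊤ := by simp [U]
    rw [this, finrank_top]
    omega
  by_contra hlt
  push Not at hlt
  have : Finite V := Module.finite_of_finite F
  have : Finite W := Module.finite_of_finite F
  have : Finite (V →ₗ[F] W) := Module.finite_of_finite F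
  have := Fintype.ofFinite V
  have := Fintype.ofFinite A
  set q := Nat.card F with hq
  have hq1 : 1 < q := Finite.one_lt_card
  -- Double count of the pairs `(v, X)` with `X v = 0`. Each `X` kills at least `q ^ (n - a)`
  -- vectors, whereas a vector outside `U` is killed by only `q ^ (m * a - m)` maps.
  have hcount := Finset.sum_card_bipartiteAbove_eq_sum_card_bipartiteBelow
    (s := (Finset.univ : Finset V)) (t := (Finset.univ : Finset A))
    (fun v (X : A) => (X : V →ₗ[F] W) v = 0)
  simp only [Finset.bipartiteAbove, Finset.bipartiteBelow] at hcount
  set n := finrank F V with hn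
  set m := finrank F W with hm
  have hker : ∀ X : A, q ^ (n - a) ≤
      (Finset.univ.filter fun v => (X : V →ₗ[F] W) v = 0).card := by
    intro X
    have h1 : (Finset.univ.filter fun v => (X : V →ₗ[F] W) v = 0).card =
        Nat.card (LinearMap.ker (X : V →ₗ[F] W)) := by
      rw [← Fintype.card_subtype, ← Nat.card_eq_fintype_card]; rfl
    rw [h1, Module.natCard_eq_pow_finrank (K := F)]
    have h2 := LinearMap.finrank_range_add_finrank_ker (X : V →ₗ[F] W)
    have h3 := hA X X.2
    exact Nat.pow_le_pow_right (by omega) (by omega)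
  have hval : ∀ v, (Finset.univ.filter fun X : A => (X : V →ₗ[F] W) v = 0).card =
      q ^ (m * a - finrank F (valuesAt A v)) := by
    intro v
    have h1 : (Finset.univ.filter fun X : A => (X : V →ₗ[F] W) v = 0).card =
        Nat.card (LinearMap.ker ((LinearMap.applyₗ v).domRestrict A : A →ₗ[F] W)) := by
      rw [← Fintype.card_subtype, ← Nat.card_eq_fintype_card]; rfl
    rw [h1, Module.natCard_eq_pow_finrank (K := F)]
    have h2 := LinearMap.finrank_range_add_finrank_ker
      ((LinearMap.applyₗ v).domRestrict A : A →ₗ[F] W)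
    rw [LinearMap.range_domRestrict, hdim] at h2
    change finrank F (valuesAt A v) + _ = _ at h2
    congr 1
    omega
  have hvU : ∀ v, (Finset.univ.filter fun X : A => (X : V →ₗ[F] W) v = 0).card ≤
      if v ∈ U then q ^ (m * a) else q ^ (m * a - m) := by
    intro v
    rw [hval]
    split_ifs with hv
    · exact Nat.pow_le_pow_right (by omega) (by omega)
    · rcases h v with h0 | h0
      · exfalso
        apply hv
        rw [hU]
        intro X hX
        rw [Submodule.finrank_eq_zero] at h0
        have : X v ∈ valuesAt A v := mem_valuesAt.2 ⟨X, hX, rfl⟩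
        rwa [h0, Submodule.mem_bot] at this
      · rw [h0]
  have hlow : q ^ (m * a) * q ^ (n - a) ≤
      ∑ X : A, (Finset.univ.filter fun v => (X : V →ₗ[F] W) v = 0).card := by
    refine le_trans ?_ (Finset.sum_le_sum fun X _ => hker X)
    rw [Finset.sum_const, Finset.card_univ, ← Nat.card_eq_fintype_card,
      Module.natCard_eq_pow_finrank (K := F), hdim, smul_eq_mul]
  have hup := Finset.sum_le_sum (s := Finset.univ) fun v _ => hvU v
  rw [hcount] at hup
  have hup' := hlow.trans hup
  rw [Finset.sum_ite, Finset.sum_const, Finset.sum_const, smul_eq_mul, smul_eq_mul] at hup'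
  have hcU : (Finset.univ.filter fun v => v ∈ U).card = q ^ finrank F U := by
    rw [← Module.natCard_eq_pow_finrank (K := F), ← Fintype.card_subtype,
      ← Nat.card_eq_fintype_card]
  have hcn : (Finset.univ.filter fun v => v ∈ U).card +
      (Finset.univ.filter fun v => ¬ v ∈ U).card = q ^ n := by
    rw [Finset.card_filter_add_card_filter_not, Finset.card_univ, ← Nat.card_eq_fintype_card,
      Module.natCard_eq_pow_finrank (K := F)]
  have hpos : 0 < q ^ finrank F U := Nat.pow_pos (by omega)
  -- Hence all vectors outside `U` together account for fewer than `q ^ (m * a)` pairs, less than a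
  -- single further vector of `U` would.
  have hnm : q ^ n ≤ q ^ m := Nat.pow_le_pow_right (by omega) hVW
  have hUa : q ^ finrank F U + 1 ≤ q ^ (n - a) :=
    Nat.pow_lt_pow_right hq1 (by omega)
  have hsplit : q ^ (m * a) = q ^ (m * a - m) * q ^ m := by
    rw [← pow_add]; congr 1
    have : m ≤ m * a := Nat.le_mul_of_pos_right m ha
    omega
  rw [hcU] at hcn hup'
  set Q := q ^ (m * a - m)
  have hQ : 0 < Q := Nat.pow_pos (by omega)
  set M := (Finset.univ.filter fun v => ¬ v ∈ U).card
  have hM : M < q ^ m := by omega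
  rw [hsplit] at hup'
  have h1 : Q * q ^ m * (q ^ finrank F U + 1) ≤ Q * q ^ m * q ^ (n - a) :=
    Nat.mul_le_mul_left _ hUa
  have h2 : M * Q < q ^ m * Q := Nat.mul_lt_mul_of_pos_right hM hQ
  nlinarith

/-- If some space of values is neither zero nor full, then it contains all images. -/
theorem range_le_valuesAt {a : ℕ} (hVW : finrank F V ≤ finrank F W)
    (haV : a ≤ finrank F V) {A : Submodule F (V →ₗ[F] W)}
    (hA : ∀ X ∈ A, finrank F (LinearMap.range X) ≤ a) (hdim : finrank F A = finrank F W * a)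
    {v : V} (h0 : finrank F (valuesAt A v) ≠ 0)
    (h1 : finrank F (valuesAt A v) ≠ finrank F W) :
    finrank F W = finrank F V ∧ finrank F (valuesAt A v) = a ∧
      ∀ X ∈ A, LinearMap.range X ≤ valuesAt A v := by
  have hv : v ≠ 0 := by
    rintro rfl
    apply h0
    rw [Submodule.finrank_eq_zero, eq_bot_iff]
    intro w hw
    obtain ⟨X, -, rfl⟩ := mem_valuesAt.1 hw
    simp
  have hV : 0 < finrank F V := finrank_pos_iff_exists_ne_zero.2 ⟨v, hv⟩
  let z : Fin (finrank F V) := ⟨0, hV⟩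
  -- For a basis that starts with `v` the first leading space is the space of values at `v`, which
  -- rules out the pattern "zero or full".
  have alt : ∀ b : Fin (finrank F V) → V, LinearIndependent F b → b z = v →
      finrank F W = finrank F V ∧ ∀ j, finrank F (lead A b j) = a := by
    intro b hb hbz
    rcases finrank_lead_of_extremal hVW haV hA hdim hb with h | h
    · exfalso
      have := h z
      rw [lead_eq_valuesAt A b z rfl, hbz] at this
      rcases this with h | h
      exacts [h0 h, h1 h]
    · exact h
  obtain ⟨b₀, hb₀, hbv⟩ := exists_extend_linearIndependent (e := 1) (Nat.succ_le_of_lt hV)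
    le_rfl ![v] (by simpa using hv)
  have hWV : finrank F W = finrank F V := (alt b₀ hb₀ (hbv 0)).1
  have hI : finrank F (valuesAt A v) = a := by
    have := (alt b₀ hb₀ (hbv 0)).2 z
    rwa [lead_eq_valuesAt A b₀ z rfl, show b₀ z = v from hbv 0] at this
  refine ⟨hWV, hI, ?_⟩
  have ha0 : 0 < a := by omega
  have han : a < finrank F V := by omega
  -- A leading vector `x` outside the values at `v` extends to a transversal of size `a` that avoids
  -- position `z`. Its span contains `x`, hence not all values at `v`, and a value `y` outside it at
  -- position `z` makes the transversal too long.
  have hlead : ∀ b : Fin (finrank F V) → V, LinearIndependent F b → b z = v →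
      ∀ j, lead A b j = valuesAt A v := by
    intro b hb hbz j
    have hdimj := (alt b hb hbz).2
    have hz : lead A b z = valuesAt A v := by rw [lead_eq_valuesAt A b z rfl, hbz]
    by_cases hjz : j = z
    · rw [hjz, hz]
    refine Submodule.eq_of_le_of_finrank_le ?_ (by rw [hdimj, hI])
    intro x hx
    by_contra hxI
    have hx0 : x ≠ 0 := by rintro rfl; exact hxI (Submodule.zero_mem _)
    obtain ⟨J, hJT, hJ, w, hw₀, hw, hli⟩ := exists_linearIndepOn_transversal (lead A b) {j}
      (fun _ => x) (by simpa using hx0) (a - 1) ((Finset.univ.erase j).erase z) (by simp)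
      (by
        intro i hi
        rw [Finset.filter_true_of_mem (by intro l _; rw [hdimj, Finset.card_singleton]; omega),
          Finset.card_erase_of_mem (by simp [Ne.symm hjz]),
          Finset.card_erase_of_mem (by simp)]
        simp
        omega)
    have hzJ : z ∉ {j} ∪ J := by
      intro h
      rcases Finset.mem_union.1 h with h | h
      · exact hjz (Finset.mem_singleton.1 h).symm
      · exact Finset.notMem_erase _ _ (hJT h)
    have hjJ : j ∉ J := fun h => by simpa using hJT h
    have hcard : ({j} ∪ J).card = a := by
      rw [Finset.card_union_of_disjoint (by simpa using hjJ), hJ]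
      simp; omega
    obtain ⟨y, hyI, hy⟩ := exists_mem_notMem_of_finrank_le (S := valuesAt A v)
      ((finrank_span_image_finset_le (F := F) w ({j} ∪ J)).trans (by omega)) (x := x)
      (Submodule.subset_span ⟨j, by simp, by simpa using hw₀ j⟩) hxI
    have heq : Set.EqOn w (Function.update w z y) ({j} ∪ J : Finset _) := by
      intro l hl
      have : l ≠ z := by rintro rfl; exact hzJ hl
      simp [this]
    have hcon := card_le_of_linearIndepOn_lead hA b (insert z ({j} ∪ J)) (Function.update w z y) 0
      (Nat.zero_le _) A.zero_mem (by simp)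
      (by
        intro l hl _
        rcases Finset.mem_insert.1 hl with rfl | hl
        · rw [Function.update_self, hz]; exact hyI
        · rw [← heq hl]
          rcases Finset.mem_union.1 hl with hl | hl
          · rw [Finset.mem_singleton] at hl
            subst hl
            rw [hw₀ l (by simp)]; exact hx
          · exact hw l hl)
      (by
        rw [Finset.coe_insert, linearIndepOn_insert (by simpa using hzJ)]
        refine ⟨hli.congr heq, ?_⟩
        rw [← heq.image_eq, Function.update_self]
        exact hy)
    rw [Finset.card_insert_of_notMem hzJ] at hcon
    omega
  -- The same exchange, now keeping the two independent values `Y v` and `Y u` of one map at the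
  -- head of a basis.
  have main : ∀ Y ∈ A, Y v ≠ 0 → ∀ u, Y u ∈ valuesAt A v := by
    intro Y hY hYv u
    by_contra hu
    have hYvI : Y v ∈ valuesAt A v := mem_valuesAt.2 ⟨Y, hY, rfl⟩
    have hindep : LinearIndependent F ![Y v, Y u] := by
      rw [LinearIndependent.pair_iff' hYv]
      intro c hc
      exact hu (hc ▸ Submodule.smul_mem _ c hYvI)
    have hvu : LinearIndependent F ![v, u] := by
      apply LinearIndependent.of_comp Y
      convert hindep using 1
      ext i; fin_cases i <;> rfl
    have hV2 : 2 ≤ finrank F V := by simpa using hvu.fintype_card_le_finrank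
    obtain ⟨b, hb, hbu⟩ := exists_extend_linearIndependent hV2 le_rfl ![v, u] hvu
    let o : Fin (finrank F V) := ⟨1, by omega⟩
    have hbz : b z = v := hbu 0
    have hbo : b o = u := hbu 1
    have hzo : z ≠ o := by simp [z, o]
    have hli₀ : LinearIndepOn F (fun l => Y (b l)) ({z, o} : Finset (Fin (finrank F V))) := by
      rw [Finset.coe_pair, LinearIndepOn.pair_iff _ hzo]
      rw [LinearIndependent.pair_iff] at hindep
      simpa [hbz, hbo] using hindep
    rcases Nat.lt_or_ge 1 a with ha1 | ha1
    -- Position `e` is reserved for the extra vector; it exists because `2 ≤ a < finrank F V`. For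
    -- `a = 1` the rank of `Y` is already too large.
    · let e : Fin (finrank F V) := ⟨2, by omega⟩
      have hez : e ≠ z := by simp [e, z]
      have heo : e ≠ o := by simp [e, o]
      have hdimj := (alt b hb hbz).2
      obtain ⟨J, hJT, hJ, w, hw₀, hw, hli⟩ := exists_linearIndepOn_transversal (lead A b) {z, o}
        (fun l => Y (b l)) hli₀ (a - 2) (((Finset.univ.erase z).erase o).erase e) (by simp)
        (by
          intro i hi
          rw [Finset.filter_true_of_mem
              (by intro l _; rw [hdimj, Finset.card_pair hzo]; omega),
            Finset.card_erase_of_mem (by simp [hez, heo]),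
            Finset.card_erase_of_mem (by simp [hzo.symm]),
            Finset.card_erase_of_mem (by simp)]
          simp
          omega)
      have hdisj : Disjoint {z, o} J := by
        refine Finset.disjoint_of_subset_right hJT ?_
        simp
      have heJ : e ∉ {z, o} ∪ J := by
        intro h
        rcases Finset.mem_union.1 h with h | h
        · simp [hez, heo] at h
        · exact Finset.notMem_erase _ _ (hJT h)
      have hcard : ({z, o} ∪ J).card = a := by
        rw [Finset.card_union_of_disjoint hdisj, hJ, Finset.card_pair hzo]
        omega
      obtain ⟨y, hyI, hy⟩ := exists_mem_notMem_of_finrank_le (S := valuesAt A v)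
        ((finrank_span_image_finset_le (F := F) w ({z, o} ∪ J)).trans (by omega)) (x := Y u)
        (Submodule.subset_span ⟨o, by simp, by rw [hw₀ o (by simp), hbo]⟩) hu
      have heq : Set.EqOn w (Function.update w e y) ({z, o} ∪ J : Finset _) := by
        intro l hl
        have : l ≠ e := by rintro rfl; exact heJ hl
        simp [this]
      have hcon := card_le_of_linearIndepOn_lead hA b (insert e ({z, o} ∪ J))
        (Function.update w e y) 2 hV2 hY
        (by
          intro l _ hl2
          have hl' : l = z ∨ l = o := by
            simp only [Fin.ext_iff, z, o]; omega
          have hlm : l ∈ ({z, o} : Finset (Fin (finrank F V))) := by simpa using hl'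
          rw [← heq (Finset.mem_union_left _ hlm), hw₀ l hlm])
        (by
          intro l hl hl2
          rcases Finset.mem_insert.1 hl with rfl | hl
          · rw [Function.update_self, hlead b hb hbz]; exact hyI
          · rw [← heq hl]
            rcases Finset.mem_union.1 hl with hl | hl
            · exfalso
              simp only [Finset.mem_insert, Finset.mem_singleton, Fin.ext_iff, z, o] at hl
              omega
            · exact hw l hl)
        (by
          rw [Finset.coe_insert, linearIndepOn_insert (by simpa using heJ)]
          refine ⟨hli.congr heq, ?_⟩
          rw [← heq.image_eq, Function.update_self]
          exact hy)
      rw [Finset.card_insert_of_notMem heJ] at hcon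
      omega
    · have h2 := (card_le_finrank_range_of_linearIndepOn hli₀).trans (hA Y hY)
      rw [Finset.card_pair hzo] at h2
      omega
  obtain ⟨Y, hY, hYv⟩ : ∃ Y ∈ A, Y v ≠ 0 := by
    by_contra hcon
    push Not at hcon
    apply h0
    rw [Submodule.finrank_eq_zero, eq_bot_iff]
    intro w hw
    obtain ⟨X, hX, rfl⟩ := mem_valuesAt.1 hw
    simp [hcon X hX]
  rintro X hX _ ⟨u, rfl⟩
  by_cases hXv : X v = 0
  -- A map that kills `v` is the difference of two maps that do not.
  · have h2 := main (X + Y) (A.add_mem hX hY) (by simpa [hXv] using hYv) u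
    have h3 := main Y hY hYv u
    simpa using Submodule.sub_mem _ h2 h3
  · exact main X hX hXv u

/-- Classification of the extremal spaces of linear maps of bounded rank over a finite field:
either they annihilate a common subspace, or all images lie in a common subspace. -/
theorem exists_annihilated_or_range_le [Finite F] {a : ℕ} (hVW : finrank F V ≤ finrank F W)
    (haV : a ≤ finrank F V) {A : Submodule F (V →ₗ[F] W)}
    (hA : ∀ X ∈ A, finrank F (LinearMap.range X) ≤ a) (hdim : finrank F A = finrank F W * a) :
    (∃ U : Submodule F V, finrank F V ≤ finrank F U + a ∧ ∀ X ∈ A, ∀ v ∈ U, X v = 0) ∨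
      (finrank F W = finrank F V ∧
        ∃ I : Submodule F W, finrank F I = a ∧ ∀ X ∈ A, LinearMap.range X ≤ I) := by
  by_cases h : ∀ v, finrank F (valuesAt A v) = 0 ∨ finrank F (valuesAt A v) = finrank F W
  · exact Or.inl (exists_annihilated_of_valuesAt hVW hA hdim h)
  · push Not at h
    obtain ⟨v, h0, h1⟩ := h
    obtain ⟨hWV, hI, hr⟩ := range_le_valuesAt hVW haV hA hdim h0 h1
    exact Or.inr ⟨hWV, _, hI, hr⟩

end BoundedRank

end SumRank

/-! ### Optimal anticodes and how to shrink them -/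

namespace SumRank

open Module

section Anticodes

variable {F : Type*} [Field F]

/-- `A` is an optimal anticode whose largest rank is `r`. -/
structure IsOptimalOfRank {a b : ℕ} (A : Submodule F (Matrix (Fin a) (Fin b) F)) (r : ℕ) :
    Prop where
  rank_le : ∀ X ∈ A, X.rank ≤ r
  exists_rank_eq : ∃ X ∈ A, X.rank = r
  finrank_eq : finrank F A = a * r

theorem IsOptimalOfRank.le_width {a b : ℕ} {A : Submodule F (Matrix (Fin a) (Fin b) F)} {r : ℕ}
    (h : IsOptimalOfRank A r) : r ≤ b := by
  obtain ⟨X, -, rfl⟩ := h.exists_rank_eq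
  exact X.rank_le_width

theorem IsOptimalOfRank.isOptimalAnticode {a b : ℕ}
    {A : Submodule F (Matrix (Fin a) (Fin b) F)} {r : ℕ} (h : IsOptimalOfRank A r) :
    IsOptimalAnticode A := by
  rw [IsOptimalAnticode, h.finrank_eq]
  refine (IsGreatest.csSup_eq ⟨?_, ?_⟩).symm
  · obtain ⟨X, hX, hr⟩ := h.exists_rank_eq
    exact ⟨X, hX, by rw [hr]⟩
  · rintro _ ⟨X, hX, rfl⟩
    exact Nat.mul_le_mul_left _ (h.rank_le X hX)

theorem IsOptimalAnticode.exists_isOptimalOfRank {a b : ℕ} (ha : 0 < a)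
    {A : Submodule F (Matrix (Fin a) (Fin b) F)} (h : IsOptimalAnticode A) :
    ∃ r, IsOptimalOfRank A r := by
  have hbdd : BddAbove {w | ∃ X ∈ A, a * X.rank = w} := by
    refine ⟨a * b, ?_⟩
    rintro _ ⟨X, -, rfl⟩
    exact Nat.mul_le_mul_left _ X.rank_le_width
  have hmem := Nat.sSup_mem (s := {w | ∃ X ∈ A, a * X.rank = w})
    ⟨_, 0, A.zero_mem, rfl⟩ hbdd
  rw [IsOptimalAnticode] at h
  rw [← h] at hmem
  obtain ⟨X, hX, hr⟩ := hmem
  refine ⟨X.rank, fun Y hY => ?_, ⟨X, hX, rfl⟩, hr.symm⟩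
  have : a * Y.rank ≤ a * X.rank := by
    rw [hr, h]
    exact le_csSup hbdd ⟨Y, hY, rfl⟩
  exact Nat.le_of_mul_le_mul_left this ha

/-- The matrices that annihilate the subspace `U`. -/
def annihilating (a : ℕ) {b : ℕ} (U : Submodule F (Fin b → F)) :
    Submodule F (Matrix (Fin a) (Fin b) F) where
  carrier := {X | ∀ v ∈ U, X.mulVec v = 0}
  add_mem' := fun hX hY v hv => by rw [Matrix.add_mulVec, hX v hv, hY v hv, add_zero]
  zero_mem' := fun v _ => Matrix.zero_mulVec v
  smul_mem' := fun c X hX v hv => by rw [Matrix.smul_mulVec, hX v hv, smul_zero]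

theorem mem_annihilating {a b : ℕ} {U : Submodule F (Fin b → F)}
    {X : Matrix (Fin a) (Fin b) F} : X ∈ annihilating a U ↔ ∀ v ∈ U, X.mulVec v = 0 :=
  Iff.rfl

theorem rank_add_finrank_le {a b : ℕ} {U : Submodule F (Fin b → F)}
    {X : Matrix (Fin a) (Fin b) F} (hX : ∀ v ∈ U, X.mulVec v = 0) :
    X.rank + finrank F U ≤ b := by
  have h := LinearMap.finrank_range_add_finrank_ker X.mulVecLin
  rw [finrank_fin_fun] at h
  have h2 : finrank F U ≤ finrank F (LinearMap.ker X.mulVecLin) :=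
    Submodule.finrank_mono fun v hv => by simpa using hX v hv
  rw [Matrix.rank]
  omega

/-- Linear maps on the quotient by `U`, as matrices. -/
noncomputable def quotientToMatrix (a : ℕ) {b : ℕ} (U : Submodule F (Fin b → F)) :
    (((Fin b → F) ⧸ U) →ₗ[F] (Fin a → F)) →ₗ[F] Matrix (Fin a) (Fin b) F :=
  LinearMap.toMatrix'.toLinearMap ∘ₗ LinearMap.lcomp F (Fin a → F) U.mkQ

theorem quotientToMatrix_mulVec {a b : ℕ} (U : Submodule F (Fin b → F))
    (f : ((Fin b → F) ⧸ U) →ₗ[F] (Fin a → F)) (v : Fin b → F) :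
    (quotientToMatrix a U f).mulVec v = f (U.mkQ v) := by
  have : quotientToMatrix a U f = LinearMap.toMatrix' (f ∘ₗ U.mkQ) := rfl
  rw [this, LinearMap.toMatrix'_mulVec]
  rfl

/-- These matrices are the linear maps from the `r`-dimensional quotient by `U` to `F^a`. As `r ≤
a`, one of them is injective and attains rank `r`. -/
theorem isOptimalOfRank_annihilating {a b r : ℕ} (hra : r ≤ a) {U : Submodule F (Fin b → F)}
    (hU : finrank F U + r = b) : IsOptimalOfRank (annihilating a U) r := by
  have hq : finrank F ((Fin b → F) ⧸ U) = r := by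
    have := U.finrank_quotient_add_finrank
    rw [finrank_fin_fun] at this
    omega
  refine ⟨fun X hX => ?_, ?_, ?_⟩
  · have := rank_add_finrank_le hX
    omega
  · obtain ⟨f, hf⟩ : ∃ f : ((Fin b → F) ⧸ U) →ₗ[F] (Fin a → F), Function.Injective f :=
      finrank_le_iff_exists_linearMap.1 (by rw [hq, finrank_fin_fun]; exact hra)
    refine ⟨quotientToMatrix a U f, fun v hv => ?_, ?_⟩
    · rw [quotientToMatrix_mulVec]
      rw [← Submodule.ker_mkQ U, LinearMap.mem_ker] at hv
      rw [hv, map_zero]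
    · have : (quotientToMatrix a U f).mulVecLin = f ∘ₗ U.mkQ := by
        refine LinearMap.ext fun v => ?_
        rw [Matrix.mulVecLin_apply, quotientToMatrix_mulVec]
        rfl
      rw [Matrix.rank, this, LinearMap.range_comp_of_range_eq_top _ U.range_mkQ,
        LinearMap.finrank_range_of_inj hf, hq]
  · have hrange : LinearMap.range (quotientToMatrix a U) = annihilating a U := by
      ext X
      constructor
      · rintro ⟨f, rfl⟩ v hv
        rw [quotientToMatrix_mulVec]
        rw [← Submodule.ker_mkQ U, LinearMap.mem_ker] at hv
        rw [hv, map_zero]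
      · intro hX
        refine ⟨U.liftQ X.mulVecLin fun v hv => by simpa using hX v hv, ?_⟩
        apply Matrix.mulVec_injective
        ext1 v
        rw [quotientToMatrix_mulVec]
        simp
    have hinj : Function.Injective (quotientToMatrix a U) := by
      intro f g hfg
      apply Submodule.linearMap_qext
      ext1 v
      ext
      simp only [LinearMap.comp_apply]
      rw [← quotientToMatrix_mulVec, ← quotientToMatrix_mulVec, hfg]
    rw [← hrange, LinearMap.finrank_range_of_inj hinj, Module.finrank_linearMap, hq,
      finrank_fin_fun, mul_comm]

/-- The transposes of the matrices in `A`. -/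
def transposed {a b : ℕ} (A : Submodule F (Matrix (Fin a) (Fin b) F)) :
    Submodule F (Matrix (Fin b) (Fin a) F) :=
  A.map (Matrix.transposeLinearEquiv (Fin a) (Fin b) F F).toLinearMap

theorem mem_transposed {a b : ℕ} {A : Submodule F (Matrix (Fin a) (Fin b) F)}
    {X : Matrix (Fin b) (Fin a) F} : X ∈ transposed A ↔ X.transpose ∈ A := by
  constructor
  · rintro ⟨Y, hY, rfl⟩
    simpa using hY
  · intro h
    exact ⟨_, h, by simp⟩

/-- Restricted to square matrices because optimality measures the dimension in multiples of the
number of rows. -/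
theorem IsOptimalOfRank.transposed {a r : ℕ} {A : Submodule F (Matrix (Fin a) (Fin a) F)}
    (h : IsOptimalOfRank A r) : IsOptimalOfRank (transposed A) r := by
  refine ⟨fun X hX => ?_, ?_, ?_⟩
  · rw [← Matrix.rank_transpose]
    exact h.rank_le _ (mem_transposed.1 hX)
  · obtain ⟨X, hX, hr⟩ := h.exists_rank_eq
    exact ⟨X.transpose, mem_transposed.2 (by simpa using hX), by rw [Matrix.rank_transpose, hr]⟩
  · rw [← h.finrank_eq]
    exact LinearEquiv.finrank_map_eq _ _

/-- A space of matrices of rank at most `r` that annihilates a subspace of codimension `r` meets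
the kernel of an evaluation map in a smaller anticode. -/
theorem IsOptimalOfRank.exists_annihilating {a b r : ℕ}
    {A : Submodule F (Matrix (Fin a) (Fin b) F)} (h : IsOptimalOfRank A (r + 1))
    {U : Submodule F (Fin b → F)} (hU : b ≤ finrank F U + (r + 1))
    (hAU : ∀ X ∈ A, ∀ v ∈ U, X.mulVec v = 0) :
    ∃ (U' : Submodule F (Fin b → F)) (v : Fin b → F), finrank F U' + r = b ∧
      ∀ X ∈ A, X.mulVec v = 0 → X ∈ annihilating a U' := by
  obtain ⟨X, hX, hr⟩ := h.exists_rank_eq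
  have hle := rank_add_finrank_le (hAU X hX)
  have hne : U ≠ ⊤ := by
    rintro rfl
    rw [finrank_top, finrank_fin_fun] at hle
    omega
  obtain ⟨v, -, hv⟩ := SetLike.exists_of_lt hne.lt_top
  -- The matrix of rank `r + 1` forces `U` to have codimension exactly `r + 1`, so one more vector
  -- brings it to `r`.
  refine ⟨U ⊔ Submodule.span F {v}, v, ?_, ?_⟩
  · have : finrank F (U ⊔ Submodule.span F {v} : Submodule F (Fin b → F)) = finrank F U + 1 :=
      Submodule.finrank_sup_span_singleton hv
    omega
  · intro Y hY hYv u hu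
    obtain ⟨x, hx, y, hy, rfl⟩ := Submodule.mem_sup.1 hu
    obtain ⟨c, rfl⟩ := Submodule.mem_span_singleton.1 hy
    rw [Matrix.mulVec_add, Matrix.mulVec_smul, hAU Y hY x hx, hYv, smul_zero, add_zero]

theorem finrank_dotProduct_orthogonal {b : ℕ} (I : Submodule F (Fin b → F)) :
    ∃ U : Submodule F (Fin b → F), finrank F U + finrank F I = b ∧
      ∀ u ∈ U, ∀ x ∈ I, u ⬝ᵥ x = 0 := by
  refine ⟨I.dualAnnihilator.comap (dotProductEquiv F (Fin b)).toLinearMap, ?_, ?_⟩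
  · have h1 := Subspace.finrank_add_finrank_dualAnnihilator_eq I
    rw [finrank_fin_fun] at h1
    have h2 : finrank F (I.dualAnnihilator.comap (dotProductEquiv F (Fin b)).toLinearMap) =
        finrank F I.dualAnnihilator := by
      rw [← LinearEquiv.finrank_map_eq (dotProductEquiv F (Fin b))
        (I.dualAnnihilator.comap (dotProductEquiv F (Fin b)).toLinearMap)]
      rw [Submodule.map_comap_eq_of_surjective (dotProductEquiv F (Fin b)).surjective]
    omega
  · intro u hu x hx
    rw [Submodule.mem_comap, Submodule.mem_dualAnnihilator] at hu
    simpa using hu x hx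

/-- In every optimal anticode of positive rank some linear map to `F^a` has a kernel that lies in
an optimal anticode of rank one less. -/
theorem IsOptimalOfRank.exists_shrink [Finite F] {a b r : ℕ} (hba : b ≤ a)
    {A : Submodule F (Matrix (Fin a) (Fin b) F)} (h : IsOptimalOfRank A (r + 1)) :
    ∃ (A' : Submodule F (Matrix (Fin a) (Fin b) F))
      (φ : Matrix (Fin a) (Fin b) F →ₗ[F] (Fin a → F)), IsOptimalOfRank A' r ∧
      ∀ X ∈ A, φ X = 0 → X ∈ A' := by
  have hrb := h.le_width
  have hmap : finrank F (A.map (Matrix.toLin' (R := F)).toLinearMap) =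
      finrank F (Fin a → F) * (r + 1) := by
    rw [finrank_fin_fun, ← h.finrank_eq]
    exact LinearEquiv.finrank_map_eq _ _
  rcases exists_annihilated_or_range_le (by simpa using hba) (by simpa using hrb)
    (A := A.map (Matrix.toLin' (R := F)).toLinearMap) (a := r + 1)
    (by
      rintro _ ⟨X, hX, rfl⟩
      exact h.rank_le X hX) hmap with ⟨U, hU, hAU⟩ | ⟨hab, I, hI, hAI⟩
  · obtain ⟨U', v, hU', hA'⟩ := h.exists_annihilating (by simpa using hU)
      (fun X hX v hv => hAU _ ⟨X, hX, rfl⟩ v hv)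
    refine ⟨annihilating a U', (Matrix.mulVecBilin F F).flip v,
      isOptimalOfRank_annihilating (by omega) hU', fun X hX hXv => hA' X hX hXv⟩
  · have hab' : a = b := by simpa using hab
    subst hab'
    obtain ⟨U, hU, hUI⟩ := finrank_dotProduct_orthogonal I
    -- Columns lie in `I`, so the transposes annihilate its orthogonal space `U`, and the first case
    -- applies to them.
    obtain ⟨U', v, hU', hA'⟩ := h.transposed.exists_annihilating (U := U) (by omega) (by
      intro X hX u hu
      ext i
      have hi := hUI u hu (X.transpose.mulVec (Pi.single i 1))
        (hAI _ ⟨_, mem_transposed.1 hX, rfl⟩ ⟨Pi.single i 1, rfl⟩)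
      rw [Matrix.mulVec_single_one, dotProduct_comm] at hi
      exact hi)
    refine ⟨SumRank.transposed (annihilating a U'),
      (Matrix.mulVecBilin F F).flip v ∘ₗ
        (Matrix.transposeLinearEquiv (Fin a) (Fin a) F F).toLinearMap,
      (isOptimalOfRank_annihilating (by omega) hU').transposed, fun X hX hXv => ?_⟩
    rw [mem_transposed]
    exact hA' _ (mem_transposed.2 (by simpa using hX)) hXv

end Anticodes

end SumRank

/-! ### Weights of codes, the multiplicity bound, greedy weights -/

namespace SumRank

open Module

section Weights

variable {F : Type*} [Field F] {t : ℕ} {m n : Fin t → ℕ}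

theorem maxSrk_pi {A : ∀ i : Fin t, Submodule F (Matrix (Fin (m i)) (Fin (n i)) F)}
    {r : Fin t → ℕ} (h : ∀ i, IsOptimalOfRank (A i) (r i)) :
    maxSrk (Submodule.pi Set.univ A) = ∑ i, r i := by
  refine IsGreatest.csSup_eq ⟨?_, ?_⟩
  · choose X hX hr using fun i => (h i).exists_rank_eq
    exact ⟨X, fun i _ => hX i, Finset.sum_congr rfl fun i _ => hr i⟩
  · rintro _ ⟨X, hX, rfl⟩
    exact Finset.sum_le_sum fun i _ => (h i).rank_le _ (hX i trivial)

theorem wt_le {D : Submodule F (Ambient F m n)}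
    {A : ∀ i : Fin t, Submodule F (Matrix (Fin (m i)) (Fin (n i)) F)}
    {r : Fin t → ℕ} (h : ∀ i, IsOptimalOfRank (A i) (r i)) (hD : D ≤ Submodule.pi Set.univ A) :
    wt D ≤ ∑ i, r i :=
  Nat.sInf_le ⟨A, fun i => (h i).isOptimalAnticode, hD, maxSrk_pi h⟩

/-- The infimum is attained because the whole space is itself a product of optimal anticodes; this
uses `n i ≤ m i`. -/
theorem exists_wt_eq (hn : ∀ i, 0 < n i) (hnm : ∀ i, n i ≤ m i)
    (D : Submodule F (Ambient F m n)) :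
    ∃ (A : ∀ i : Fin t, Submodule F (Matrix (Fin (m i)) (Fin (n i)) F)) (r : Fin t → ℕ),
      (∀ i, IsOptimalOfRank (A i) (r i)) ∧ D ≤ Submodule.pi Set.univ A ∧ ∑ i, r i = wt D := by
  have htop : ∀ i, IsOptimalOfRank (annihilating (F := F) (m i) (⊥ : Submodule F (Fin (n i) → F)))
      (n i) := fun i => isOptimalOfRank_annihilating (hnm i) (by simp)
  obtain ⟨A, hA, hD, hw⟩ := Nat.sInf_mem (s := {w | ∃ A : ∀ i : Fin t,
    Submodule F (Matrix (Fin (m i)) (Fin (n i)) F),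
    (∀ i, IsOptimalAnticode (A i)) ∧ D ≤ Submodule.pi Set.univ A ∧
      maxSrk (Submodule.pi Set.univ A) = w})
    ⟨_, _, fun i => (htop i).isOptimalAnticode, fun X _ i _ => by simp [mem_annihilating], rfl⟩
  choose r hr using fun i => (hA i).exists_isOptimalOfRank ((hn i).trans_le (hnm i))
  exact ⟨A, r, hr, hD, (maxSrk_pi hr).symm.trans hw⟩

theorem srk_le_wt (hn : ∀ i, 0 < n i) (hnm : ∀ i, n i ≤ m i)
    {D : Submodule F (Ambient F m n)} {X : Ambient F m n} (hX : X ∈ D) :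
    srk X ≤ wt D := by
  obtain ⟨A, r, hr, hD, hw⟩ := exists_wt_eq hn hnm D
  rw [← hw]
  exact Finset.sum_le_sum fun i _ => (hr i).rank_le _ (hD hX i trivial)

theorem wt_le_sum (hn : ∀ i, 0 < n i) (hnm : ∀ i, n i ≤ m i)
    (D : Submodule F (Ambient F m n)) : wt D ≤ ∑ i, n i := by
  obtain ⟨A, r, hr, -, hw⟩ := exists_wt_eq hn hnm D
  rw [← hw]
  exact Finset.sum_le_sum fun i _ => (hr i).le_width

theorem srk_pos {X : Ambient F m n} (hX : X ≠ 0) : 0 < srk X := by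
  by_contra h
  have h0 : srk X = 0 := by omega
  rw [srk, Finset.sum_eq_zero_iff] at h0
  apply hX
  funext i
  have := h0 i (Finset.mem_univ i)
  rw [Matrix.rank, Submodule.finrank_eq_zero, LinearMap.range_eq_bot] at this
  exact Matrix.mulVec_injective (funext fun v => by simpa using LinearMap.congr_fun this v)

theorem genWeight_le {C D : Submodule F (Ambient F m n)} (hD : D ≤ C) {r : ℕ}
    (hr : r ≤ finrank F D) : genWeight C r ≤ wt D :=
  Nat.sInf_le ⟨D, hD, hr, rfl⟩

theorem exists_genWeight_eq {C : Submodule F (Ambient F m n)} {r : ℕ} (hr : r ≤ finrank F C) :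
    ∃ D ≤ C, r ≤ finrank F D ∧ wt D = genWeight C r :=
  Nat.sInf_mem (s := {w | ∃ D ≤ C, r ≤ finrank F D ∧ wt D = w}) ⟨_, C, le_rfl, hr, rfl⟩

/-- A code of weight `n₁ + ⋯ + n_{i-1} + j` has a subcode of smaller weight and codimension at
most `m_i`. -/
theorem exists_wt_lt [Finite F] (hn : ∀ i, 0 < n i) (hnm : ∀ i, n i ≤ m i)
    (hm : Antitone m) (D : Submodule F (Ambient F m n)) (i : Fin t)
    {j : ℕ} (hj : 1 ≤ j) (hD : wt D = ∑ l ∈ Finset.Iio i, n l + j) :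
    ∃ D' ≤ D, finrank F D ≤ finrank F D' + m i ∧ wt D' < wt D := by
  obtain ⟨A, r, hr, hDA, hw⟩ := exists_wt_eq hn hnm D
  obtain ⟨l, hil, hl⟩ : ∃ l, i ≤ l ∧ r l ≠ 0 := by
    by_contra hcon
    push Not at hcon
    have h1 : ∑ l, r l = ∑ l ∈ Finset.Iio i, r l := by
      symm
      apply Finset.sum_subset (Finset.subset_univ _)
      intro l _ hl
      exact hcon l (by simpa using hl)
    have h2 : ∑ l ∈ Finset.Iio i, r l ≤ ∑ l ∈ Finset.Iio i, n l :=
      Finset.sum_le_sum fun l _ => (hr l).le_width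
    omega
  obtain ⟨s, hs⟩ := Nat.exists_eq_succ_of_ne_zero hl
  have hrl := hr l
  rw [hs] at hrl
  obtain ⟨A', φ, hA', hφ⟩ := hrl.exists_shrink (hnm l)
  let ψ : Ambient F m n →ₗ[F] (Fin (m l) → F) := φ ∘ₗ LinearMap.proj l
  refine ⟨D ⊓ LinearMap.ker ψ, inf_le_left, ?_, ?_⟩
  · have h1 := finrank_map_add_finrank_inf_ker ψ D
    have h2 := Submodule.finrank_le (D.map ψ)
    rw [finrank_fin_fun] at h2
    have h3 := hm hil
    omega
  · have hle : wt (D ⊓ LinearMap.ker ψ) ≤ ∑ k, Function.update r l s k := by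
      refine wt_le (A := Function.update A l A') (fun k => ?_) ?_
      · by_cases hk : k = l
        · subst hk
          simpa using hA'
        · simpa [hk] using hr k
      · rintro X ⟨hX, hXψ⟩ k -
        by_cases hk : k = l
        · subst hk
          simpa using hφ _ (hDA hX k trivial) hXψ
        · simpa [hk] using hDA hX k trivial
    have hsum : ∑ k, Function.update r l s k < ∑ k, r k := by
      refine Finset.sum_lt_sum (fun k _ => ?_) ⟨l, Finset.mem_univ _, by simp; omega⟩
      by_cases hk : k = l
      · subst hk; simp; omega
      · simp [hk]
    omega

/-- Sequences of generalized weights are admissible. -/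
theorem IsGenWeightSeq.isAdmissible [Finite F] (hn : ∀ i, 0 < n i) (hnm : ∀ i, n i ≤ m i)
    (hm : Antitone m)
    {C : Submodule F (Ambient F m n)} {k : ℕ} {d : Fin k → ℕ} (h : IsGenWeightSeq C d) :
    IsAdmissible m n d := by
  obtain ⟨hk, hd⟩ := h
  have hex : ∀ r : Fin k, ∃ D ≤ C, (r : ℕ) + 1 ≤ finrank F D ∧ wt D = d r := fun r => by
    rw [← hd r]
    exact exists_genWeight_eq (by omega)
  refine ⟨fun r s hrs => ?_, fun r => ?_, fun i j hj => ?_⟩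
  · obtain ⟨D, hDC, hDs, hw⟩ := hex s
    rw [← hw, ← hd r]
    have : (r : ℕ) ≤ s := hrs
    exact genWeight_le hDC (by omega)
  · obtain ⟨D, hDC, hDr, hw⟩ := hex r
    rw [Finset.mem_Icc, ← hw]
    refine ⟨?_, wt_le_sum hn hnm D⟩
    have hne : D ≠ ⊥ := by
      rintro rfl
      simp at hDr
    obtain ⟨X, hX, hX0⟩ := Submodule.exists_mem_ne_zero_of_ne_bot hne
    exact (srk_pos hX0).trans_le (srk_le_wt hn hnm hX)
  · set p := ∑ l ∈ Finset.Iio i, n l + j with hp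
    set S := Finset.univ.filter fun r : Fin k => d r = p with hS
    rcases S.eq_empty_or_nonempty with h0 | hne
    · simp [h0]
    by_contra hcon
    push Not at hcon
    have hmin := S.min'_mem hne
    have hmax := S.max'_mem hne
    set a := S.min' hne
    set b := S.max' hne
    have hsub : S ⊆ Finset.Icc a b := fun r hr =>
      Finset.mem_Icc.2 ⟨S.min'_le r hr, S.le_max' r hr⟩
    have hcard := Finset.card_le_card hsub
    rw [Fin.card_Icc] at hcard
    rw [hS, Finset.mem_filter] at hmin hmax
    obtain ⟨D, hDC, hDb, hw⟩ := hex b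
    rw [hmax.2] at hw
    -- More than `m i` indices lie between `a` and `b`, so `D'` still has dimension at least `a +
    -- 1`, but its weight is below `p = d a`.
    obtain ⟨D', hD', hdim, hlt⟩ := exists_wt_lt hn hnm hm D i (Finset.mem_Icc.1 hj).1 hw
    have := genWeight_le (hD'.trans hDC) (r := (a : ℕ) + 1) (by omega)
    rw [hd a, hmin.2] at this
    omega

/-- Under the chain condition the greedy weights are the generalized weights. -/
theorem ChainCondition.isGreedyWeightSeq {C : Submodule F (Ambient F m n)}
    (h : ChainCondition C) {k : ℕ} {d : Fin k → ℕ} (hd : IsGenWeightSeq C d) :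
    IsGreedyWeightSeq C d := by
  obtain ⟨D, hD0, hDk, hlt, hw⟩ := h
  obtain ⟨hk, hd⟩ := hd
  rw [hk] at hDk hlt hw
  have hmono : ∀ r ≤ k, D r ≤ C := by
    intro r hr
    induction hr using Nat.decreasingInduction with
    | self => exact hDk.le
    | of_succ r hr ih => exact (hlt r hr).le.trans ih
  -- Strictness pins the dimensions down: climbing from zero bounds them below, descending from `C`
  -- bounds them above.
  have hge : ∀ r ≤ k, r ≤ finrank F (D r) := by
    intro r
    induction r with
    | zero => simp
    | succ r ih =>
      intro hr
      have h1 := ih (by omega)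
      have h2 := Submodule.finrank_lt_finrank_of_lt (hlt r hr)
      omega
  have hle : ∀ r ≤ k, finrank F (D r) ≤ r := by
    intro r hr
    induction hr using Nat.decreasingInduction with
    | self => rw [hDk, hk]
    | of_succ r hr ih =>
      have h2 := Submodule.finrank_lt_finrank_of_lt (hlt r hr)
      omega
  have hfin : ∀ r ≤ k, finrank F (D r) = r := fun r hr => le_antisymm (hle r hr) (hge r hr)
  have hgreedy : ∀ r, r + 1 ≤ k → IsGreedySubcode C (r + 1) (D (r + 1)) := by
    intro r
    induction r with
    | zero =>
      intro hr
      exact ⟨hmono _ hr, hfin _ hr, (hw 1 (by simpa using hr)).symm⟩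
    | succ r ih =>
      intro hr
      refine ⟨⟨hmono _ hr, hfin _ hr, D (r + 1), (hlt (r + 1) hr).le, ih (by omega)⟩, ?_⟩
      rintro D' ⟨hD', hfin', -⟩
      rw [← hw (r + 2) (Finset.mem_Icc.2 ⟨by omega, hr⟩)]
      exact genWeight_le hD' hfin'.ge
  -- The chain members compete in the greedy minimum and already attain the generalized weight, a
  -- lower bound for all competitors.
  have hwt : ∀ r, r + 1 ≤ k → ∀ E, IsGreedySubcode C (r + 1) E → wt E = genWeight C (r + 1) := by
    intro r hr E hE
    cases r with
    | zero => exact hE.2.2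
    | succ r =>
      apply le_antisymm
      · rw [hw (r + 2) (Finset.mem_Icc.2 ⟨by omega, hr⟩)]
        exact hE.2 _ (hgreedy (r + 1) hr).1
      · exact genWeight_le hE.1.1 hE.1.2.1.ge
  refine ⟨hk, fun r => ?_⟩
  rw [← hd r, greedyWeight]
  have hset : {w | ∃ E, IsGreedySubcode C ((r : ℕ) + 1) E ∧ wt E = w} =
      {genWeight C ((r : ℕ) + 1)} := by
    ext w
    constructor
    · rintro ⟨E, hE, rfl⟩
      exact hwt r r.2 E hE
    · rintro rfl
      exact ⟨_, hgreedy r r.2, hwt r r.2 _ (hgreedy r r.2)⟩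
  rw [hset, csInf_singleton]

end Weights

end SumRank

/-! ### Construction of codes from the chain of MSRD codes -/

namespace SumRank

open Module

section Construction

variable {F : Type*} [Field F]

/-- The vectors whose first `c` coordinates vanish. -/
def tailSpace (F : Type*) [Field F] (b c : ℕ) : Submodule F (Fin b → F) where
  carrier := {v | ∀ x : Fin b, (x : ℕ) < c → v x = 0}
  add_mem' := fun hv hw x hx => by simp [hv x hx, hw x hx]
  zero_mem' := fun _ _ => rfl
  smul_mem' := fun a v hv x hx => by simp [hv x hx]

theorem finrank_tailSpace {b c : ℕ} (hcb : c ≤ b) : finrank F (tailSpace F b c) + c = b := by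
  have h := LinearMap.finrank_range_add_finrank_ker (LinearMap.funLeft F F (Fin.castLE hcb))
  rw [LinearMap.range_eq_top.2
    (LinearMap.funLeft_surjective_of_injective F F _ (Fin.castLE_injective hcb)), finrank_top,
    finrank_fin_fun, finrank_fin_fun] at h
  have hker : LinearMap.ker (LinearMap.funLeft F F (Fin.castLE hcb)) = tailSpace F b c := by
    ext v
    rw [LinearMap.mem_ker, funext_iff]
    constructor
    · intro hv x hx
      exact hv ⟨x, hx⟩
    · intro hv x
      exact hv (Fin.castLE hcb x) x.2
  rw [hker] at h
  omega

theorem finrank_submodule_pi {t : ℕ} {M : Fin t → Type*} [∀ i, AddCommGroup (M i)]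
    [∀ i, Module F (M i)] [∀ i, FiniteDimensional F (M i)] (A : ∀ i, Submodule F (M i)) :
    finrank F (Submodule.pi Set.univ A) = ∑ i, finrank F (A i) := by
  let f : (∀ i, A i) →ₗ[F] ∀ i, M i := LinearMap.pi fun i => (A i).subtype ∘ₗ LinearMap.proj i
  have hf : Function.Injective f := fun x y h => by
    funext i
    exact Subtype.ext (congr_fun h i)
  have hr : LinearMap.range f = Submodule.pi Set.univ A := by
    ext X
    constructor
    · rintro ⟨x, rfl⟩ i -
      exact (x i).2
    · intro hX
      exact ⟨fun i => ⟨X i, hX i trivial⟩, rfl⟩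
  rw [← hr, LinearMap.finrank_range_of_inj hf, finrank_pi_fintype]

theorem finrank_span_image_eq_card {M ι : Type*} [AddCommGroup M] [Module F M] {x : ι → M}
    (hx : LinearIndependent F x) (S : Finset ι) :
    finrank F (Submodule.span F (x '' (S : Set ι))) = S.card := by
  have h := finrank_span_eq_card (hx.comp ((↑) : S → ι) Subtype.val_injective)
  rw [Set.range_comp, Subtype.range_coe_subtype] at h
  simpa using h

variable {t : ℕ} {m n : Fin t → ℕ}

/-- The number of columns of the `i`-th block among the first `p` columns. -/
def columnCount (n : Fin t → ℕ) (p : ℕ) (i : Fin t) : ℕ :=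
  min (n i) (p - ∑ l ∈ Finset.Iio i, n l)

theorem sum_Iio_add_le (n : Fin t → ℕ) {i j : Fin t} (hij : i < j) :
    ∑ l ∈ Finset.Iio i, n l + n i ≤ ∑ l ∈ Finset.Iio j, n l := by
  have : insert i (Finset.Iio i) ⊆ Finset.Iio j := by
    intro l hl
    rw [Finset.mem_insert, Finset.mem_Iio] at hl
    rw [Finset.mem_Iio]
    rcases hl with rfl | hl
    exacts [hij, hl.trans hij]
  have h := Finset.sum_le_sum_of_subset (f := n) this
  rw [Finset.sum_insert (by simp)] at h
  omega

theorem block_unique {i i' : Fin t} {j j' : ℕ} (hj : j ∈ Finset.Icc 1 (n i))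
    (hj' : j' ∈ Finset.Icc 1 (n i'))
    (h : ∑ l ∈ Finset.Iio i, n l + j = ∑ l ∈ Finset.Iio i', n l + j') : i = i' ∧ j = j' := by
  rw [Finset.mem_Icc] at hj hj'
  rcases lt_trichotomy i i' with hii | rfl | hii
  · have := sum_Iio_add_le n hii
    omega
  · exact ⟨rfl, by omega⟩
  · have := sum_Iio_add_le n hii
    omega

/-- Used with `f = m` for the dimension of `firstColumns` and with `f = 1` for its maximum sum-rank.
-/
theorem sum_mul_columnCount (f : Fin t → ℕ) {i : Fin t} {j : ℕ} (hj : j ∈ Finset.Icc 1 (n i)) :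
    ∑ l, f l * columnCount n (∑ l ∈ Finset.Iio i, n l + j) l =
      ∑ l ∈ Finset.Iio i, f l * n l + f i * j := by
  rw [Finset.mem_Icc] at hj
  have hsub : ∑ l, f l * columnCount n (∑ l ∈ Finset.Iio i, n l + j) l =
      ∑ l ∈ insert i (Finset.Iio i), f l * columnCount n (∑ l ∈ Finset.Iio i, n l + j) l := by
    symm
    apply Finset.sum_subset (Finset.subset_univ _)
    intro l _ hl
    rw [Finset.mem_insert, Finset.mem_Iio, not_or, not_lt] at hl
    have := sum_Iio_add_le n (lt_of_le_of_ne hl.2 (Ne.symm hl.1))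
    rw [columnCount, Nat.sub_eq_zero_of_le (by omega)]
    simp
  rw [hsub, Finset.sum_insert (by simp), add_comm]
  congr 1
  · apply Finset.sum_congr rfl
    intro l hl
    have := sum_Iio_add_le n (Finset.mem_Iio.1 hl)
    rw [columnCount, min_eq_left (by omega)]
  · rw [columnCount, Nat.add_sub_cancel_left, min_eq_right hj.2]

/-- The matrix tuples that are supported on the first `p` columns. -/
def firstColumns (F : Type*) [Field F] (m n : Fin t → ℕ) (p : ℕ) :
    Submodule F (Ambient F m n) :=
  Submodule.pi Set.univ fun i => annihilating (m i) (tailSpace F (n i) (columnCount n p i))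

theorem firstColumns_mono {p p' : ℕ} (h : p ≤ p') :
    firstColumns F m n p ≤ firstColumns F m n p' := by
  intro X hX i hi v hv
  refine hX i hi v fun x hx => hv x (hx.trans_le ?_)
  exact min_le_min_left _ (Nat.sub_le_sub_right h _)

theorem isOptimalOfRank_firstColumns (hnm : ∀ i, n i ≤ m i) (p : ℕ) (i : Fin t) :
    IsOptimalOfRank (annihilating (m i) (tailSpace F (n i) (columnCount n p i)))
      (columnCount n p i) :=
  isOptimalOfRank_annihilating ((min_le_left _ _).trans (hnm i))
    (finrank_tailSpace (min_le_left _ _))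

theorem srk_le_of_mem_firstColumns (hnm : ∀ i, n i ≤ m i) {p : ℕ} {X : Ambient F m n}
    (hX : X ∈ firstColumns F m n p) : srk X ≤ ∑ i, columnCount n p i :=
  Finset.sum_le_sum fun i _ =>
    (isOptimalOfRank_firstColumns hnm p i).rank_le _ (hX i trivial)

theorem finrank_firstColumns (hnm : ∀ i, n i ≤ m i) (p : ℕ) :
    finrank F (firstColumns F m n p) = ∑ i, m i * columnCount n p i := by
  rw [firstColumns, finrank_submodule_pi]
  exact Finset.sum_congr rfl fun i _ => (isOptimalOfRank_firstColumns hnm p i).finrank_eq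

theorem minDist_le {D : Submodule F (Ambient F m n)} {X : Ambient F m n} (hX : X ∈ D)
    (h0 : X ≠ 0) : minDist D ≤ srk X :=
  Nat.sInf_le ⟨X, hX, h0, rfl⟩

theorem finrank_ambient : finrank F (Ambient F m n) = ∑ i, m i * n i := by
  rw [finrank_pi_fintype]
  exact Finset.sum_congr rfl fun i _ => by simp [finrank_matrix]

/-- An MSRD code of minimum distance `p` meets the space of tuples supported on the first `p`
columns in dimension at least `m_i`. -/
theorem IsMSRD.le_finrank_inf (hnm : ∀ i, n i ≤ m i) {D : Submodule F (Ambient F m n)}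
    (hD : IsMSRD D) {i : Fin t} {j : ℕ} (hj : j ∈ Finset.Icc 1 (n i))
    (hd : minDist D = ∑ l ∈ Finset.Iio i, n l + j) :
    m i ≤ finrank F (firstColumns F m n (minDist D) ⊓ D : Submodule F (Ambient F m n)) := by
  obtain ⟨i', δ, hδ, hd', hdim⟩ := hD
  obtain ⟨rfl, rfl⟩ := block_unique (j' := δ + 1) hj
    (Finset.mem_Icc.2 ⟨by omega, hδ⟩) (by omega)
  have h1 := Submodule.finrank_sup_add_finrank_inf_eq (firstColumns F m n (minDist D)) D
  -- The two dimensions add up to that of the ambient space plus `m i`: block `i` contributes `δ +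
  -- 1` columns to one and loses `δ` in the other.
  have h2 := Submodule.finrank_le (firstColumns F m n (minDist D) ⊔ D)
  have h3 := finrank_firstColumns (F := F) hnm (minDist D)
  rw [hd, sum_mul_columnCount m hj, ← hd] at h3
  have h4 : ∑ l ∈ Finset.Iio i, m l * n l + ∑ l ∈ Finset.Ici i, m l * n l = ∑ l, m l * n l := by
    rw [← Finset.sum_union]
    · congr 1
      ext l
      simp [lt_or_ge]
    · rw [Finset.disjoint_left]
      intro l hl hl'
      rw [Finset.mem_Iio] at hl
      rw [Finset.mem_Ici] at hl'
      exact absurd hl (not_lt.2 hl')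
  rw [finrank_ambient] at h2
  have h5 : m i * (δ + 1) = δ * m i + m i := by ring
  omega

theorem IsAdmissible.comp {k K : ℕ} {d : Fin K → ℕ} (h : IsAdmissible m n d) {e : Fin k → Fin K}
    (he : StrictMono e) : IsAdmissible m n (d ∘ e) := by
  refine ⟨h.1.comp he.monotone, fun r => h.2.1 _, fun i j hj => le_trans ?_ (h.2.2 i j hj)⟩
  refine Finset.card_le_card_of_injOn e (fun r hr => ?_) he.injective.injOn
  simpa using hr

/-- Every admissible sequence is the sequence of generalized weights of a code with the chain
condition, if the ambient space has a full chain of MSRD codes. -/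
theorem IsAdmissible.exists_code (hn : ∀ i, 0 < n i) (hnm : ∀ i, n i ≤ m i)
    {D : ℕ → Submodule F (Ambient F m n)}
    (hD : ∀ h ∈ Finset.Ico 1 (∑ i, n i), D (h + 1) ≤ D h)
    (hMSRD : ∀ h ∈ Finset.Icc 1 (∑ i, n i), IsMSRD (D h) ∧ minDist (D h) = h)
    {k : ℕ} {d : Fin k → ℕ} (hd : IsAdmissible m n d) :
    ∃ C : Submodule F (Ambient F m n), IsGenWeightSeq C d ∧ ChainCondition C := by
  obtain ⟨hmono, hrange, hmult⟩ := hd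
  -- The position of `p` in the blocks is read off from the MSRD property of `D p`.
  have hblock : ∀ p ∈ Finset.Icc 1 (∑ i, n i), ∃ i, ∃ j ∈ Finset.Icc 1 (n i),
      p = ∑ l ∈ Finset.Iio i, n l + j := by
    intro p hp
    obtain ⟨⟨i, δ, hδ, hd, -⟩, hp'⟩ := hMSRD p hp
    exact ⟨i, δ + 1, Finset.mem_Icc.2 ⟨by omega, hδ⟩, by omega⟩
  have hcount : ∀ p ≤ ∑ i, n i, ∑ i, columnCount n p i = p := by
    intro p hp
    rcases Nat.eq_zero_or_pos p with rfl | hp0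
    · simp [columnCount]
    · obtain ⟨i, j, hj, rfl⟩ := hblock p (Finset.mem_Icc.2 ⟨hp0, hp⟩)
      simpa using sum_mul_columnCount (fun _ => 1) hj
  have hanti : ∀ p p', 1 ≤ p → p ≤ p' → p' ≤ ∑ i, n i → D p' ≤ D p := by
    intro p p' hp hpp'
    induction p', hpp' using Nat.le_induction with
    | base => exact fun _ => le_rfl
    | succ p' hpp' ih =>
      intro hp'
      exact (hD p' (Finset.mem_Ico.2 ⟨by omega, by omega⟩)).trans (ih (by omega))
  have hex : ∀ p, ∃ f : {r // d r = p} → Ambient F m n, LinearIndependent F f ∧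
      ∀ r, f r ∈ firstColumns F m n p ⊓ D p := by
    intro p
    rcases isEmpty_or_nonempty {r // d r = p} with he | ⟨⟨r, hr⟩⟩
    · exact ⟨fun _ => 0, linearIndependent_empty_type, fun r => he.elim r⟩
    · have hp : p ∈ Finset.Icc 1 (∑ i, n i) := hr ▸ hrange r
      obtain ⟨i, j, hj, hpij⟩ := hblock p hp
      have h1 := (hMSRD p hp).1.le_finrank_inf hnm hj ((hMSRD p hp).2.trans hpij)
      rw [(hMSRD p hp).2] at h1
      have h2 := hmult i j hj
      rw [← hpij, ← Fintype.card_subtype] at h2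
      obtain ⟨g, hg⟩ := exists_linearIndependent_of_le_finrank (h2.trans h1)
      refine ⟨fun r => g (Fintype.equivFin _ r), ?_, fun r => (g _).2⟩
      exact (hg.comp _ (Fintype.equivFin _).injective).map' (Submodule.subtype _)
        (Submodule.ker_subtype _)
  choose f hf hfmem using hex
  let x : Fin k → Ambient F m n := fun r => f (d r) ⟨r, rfl⟩
  have hxA : ∀ r, x r ∈ firstColumns F m n (d r) := fun r => (hfmem (d r) ⟨r, rfl⟩).1
  have hxD : ∀ r, x r ∈ D (d r) := fun r => (hfmem (d r) ⟨r, rfl⟩).2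
  have hxp : ∀ p, LinearIndepOn F x (Finset.univ.filter fun r => d r = p : Finset (Fin k)) := by
    intro p
    have h1 : LinearIndependent F fun r : {r // d r = p} => x r := by
      convert hf p using 1
      funext ⟨r, hr⟩
      subst hr
      rfl
    have h2 : LinearIndepOn F x {r | d r = p} := h1
    simpa using h2
  -- In a relation, the part of the highest occurring weight `p` lies in `D p` and, by the relation,
  -- also in the first `p - 1` columns. Its sum-rank is below the minimum distance, so it is zero.
  have hx : LinearIndependent F x := by
    classical
    rw [Fintype.linearIndependent_iff]
    intro c hc
    by_contra hcon
    push Not at hcon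
    have hne : (Finset.univ.filter fun r => c r ≠ 0).Nonempty := by
      obtain ⟨r, hr⟩ := hcon
      exact ⟨r, by simpa using hr⟩
    have hr₀ := Finset.max'_mem _ hne
    have hmax := fun r => Finset.le_max' (Finset.univ.filter fun r => c r ≠ 0) r
    set r₀ := Finset.max' _ hne
    rw [Finset.mem_filter] at hr₀
    set p := d r₀ with hp
    have hpr := Finset.mem_Icc.1 (hrange r₀)
    rw [← Finset.sum_filter_add_sum_filter_not _ (fun r => d r = p)] at hc
    have hyD : ∑ r with d r = p, c r • x r ∈ D p := Submodule.sum_mem _ fun r hr =>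
      Submodule.smul_mem _ _ ((Finset.mem_filter.1 hr).2 ▸ hxD r)
    have hyA : ∑ r with d r = p, c r • x r ∈ firstColumns F m n (p - 1) := by
      rw [eq_neg_of_add_eq_zero_left hc]
      refine Submodule.neg_mem _ (Submodule.sum_mem _ fun r hr => ?_)
      by_cases hcr : c r = 0
      · rw [hcr, zero_smul]
        exact Submodule.zero_mem _
      · have h1 := hmono (hmax r (by simpa using hcr))
        have h2 : d r ≠ p := (Finset.mem_filter.1 hr).2
        exact Submodule.smul_mem _ _
          (firstColumns_mono (Nat.le_sub_one_of_lt (lt_of_le_of_ne h1 h2)) (hxA r))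
    have hy0 : ∑ r with d r = p, c r • x r = 0 := by
      by_contra hy
      have h1 := minDist_le hyD hy
      have h2 := srk_le_of_mem_firstColumns hnm hyA
      rw [hcount _ (by omega)] at h2
      rw [(hMSRD p (hrange r₀)).2] at h1
      omega
    exact hr₀.2 (linearIndepOn_finset_iff.1 (hxp p) c hy0 r₀ (by simp [hp]))
  let C : Submodule F (Ambient F m n) := Submodule.span F (Set.range x)
  have hC : finrank F C = k := by simpa using finrank_span_eq_card hx
  let E : ℕ → Submodule F (Ambient F m n) := fun r =>
    Submodule.span F (x '' (Finset.univ.filter fun s : Fin k => (s : ℕ) < r : Finset (Fin k)))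
  have hEmono : ∀ r, E r ≤ E (r + 1) := fun r =>
    Submodule.span_mono (Set.image_mono fun s hs => by simp at hs ⊢; omega)
  have hEC : ∀ r, E r ≤ C := fun r => Submodule.span_mono (Set.image_subset_range _ _)
  have hE : ∀ r ≤ k, finrank F (E r) = r := by
    intro r hr
    rw [finrank_span_image_eq_card hx, Fin.card_filter_val_lt, min_eq_right hr]
  have hEw : ∀ r : Fin k, wt (E (r + 1)) ≤ d r := by
    intro r
    have hle : E (r + 1) ≤ firstColumns F m n (d r) := by
      refine Submodule.span_le.2 ?_
      rintro _ ⟨s, hs, rfl⟩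
      have hsr : s ≤ r := by
        have : (s : ℕ) < r + 1 := by simpa using hs
        rw [Fin.le_def]
        omega
      exact firstColumns_mono (hmono hsr) (hxA s)
    rw [← hcount (d r) (Finset.mem_Icc.1 (hrange r)).2]
    exact wt_le (isOptimalOfRank_firstColumns hnm (d r)) hle
  have hlow : ∀ r : Fin k, ∀ G ≤ C, (r : ℕ) + 1 ≤ finrank F G → d r ≤ wt G := by
    intro r G hG hGr
    -- Since `r` counts from zero, `H` has dimension `k - r` and must meet `G`. It lies in `D (d
    -- r)`, so a common nonzero element has sum-rank at least `d r`.
    let H : Submodule F (Ambient F m n) := Submodule.span F (x '' (Finset.Ici r : Finset (Fin k)))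
    have hH : finrank F H = k - r := by
      rw [finrank_span_image_eq_card hx, Fin.card_Ici]
    have hHC : H ≤ C := Submodule.span_mono (Set.image_subset_range _ _)
    have hHD : H ≤ D (d r) := by
      refine Submodule.span_le.2 ?_
      rintro _ ⟨s, hs, rfl⟩
      have hrs : r ≤ s := by simpa using hs
      exact hanti _ _ (Finset.mem_Icc.1 (hrange r)).1 (hmono hrs)
        (Finset.mem_Icc.1 (hrange s)).2 (hxD s)
    have h1 := Submodule.finrank_sup_add_finrank_inf_eq G H
    have h2 := Submodule.finrank_mono (sup_le hG hHC)
    have hne : G ⊓ H ≠ ⊥ := by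
      intro h0
      rw [h0, finrank_bot] at h1
      have := r.2
      omega
    obtain ⟨X, hX, hX0⟩ := Submodule.exists_mem_ne_zero_of_ne_bot hne
    have h3 := minDist_le (hHD hX.2) hX0
    rw [(hMSRD _ (hrange r)).2] at h3
    exact h3.trans (srk_le_wt hn hnm hX.1)
  have hgen : ∀ r : Fin k, genWeight C (r + 1) = d r ∧ wt (E (r + 1)) = d r := by
    intro r
    have hfr : (r : ℕ) + 1 ≤ finrank F (E (r + 1)) := (hE _ r.2).ge
    have h1 := genWeight_le (hEC (r + 1)) hfr
    obtain ⟨G, hG, hGr, hGw⟩ := exists_genWeight_eq (C := C) (r := (r : ℕ) + 1)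
      (by have := r.2; omega)
    have h2 := hlow r G hG hGr
    have h3 := hEw r
    omega
  refine ⟨C, ⟨hC, fun r => (hgen r).1⟩, E, ?_, ?_, ?_, ?_⟩
  · simp [E]
  · rw [hC]
    simp [E, C]
  · intro r hr
    rw [hC] at hr
    refine lt_of_le_of_ne (hEmono r) fun h => ?_
    have h1 := hE r hr.le
    rw [h, hE (r + 1) hr] at h1
    omega
  · intro r hr
    rw [hC, Finset.mem_Icc] at hr
    obtain ⟨r, rfl⟩ := Nat.exists_eq_add_of_le' hr.1
    have := hgen ⟨r, hr.2⟩
    exact this.1.trans this.2.symm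

end Construction

end SumRank

/-! ### The three statements of the theorem -/

theorem theorem4p7 {F : Type*} [Field F] [Finite F] {t : ℕ} (ht : 0 < t) (m n : Fin t → ℕ)
    (hn : ∀ i, 0 < n i) (hnm : ∀ i, n i ≤ m i) (hm : Antitone m)
    (hchain : ∃ D : ℕ → Submodule F (SumRank.Ambient F m n),
      D 1 = ⊤ ∧ (∀ h ∈ Finset.Ico 1 (∑ i, n i), D (h + 1) ≤ D h) ∧
      ∀ h ∈ Finset.Icc 1 (∑ i, n i), SumRank.IsMSRD (D h) ∧ SumRank.minDist (D h) = h) :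
    (∀ (k : ℕ) (d : Fin k → ℕ),
      (∃ C : Submodule F (SumRank.Ambient F m n), SumRank.IsGenWeightSeq C d) ↔
        SumRank.IsAdmissible m n d) ∧
    (∀ (k : ℕ) (d : Fin k → ℕ), SumRank.IsAdmissible m n d →
      ∃ C : Submodule F (SumRank.Ambient F m n), SumRank.IsGenWeightSeq C d ∧
        SumRank.ChainCondition C ∧ SumRank.IsGreedyWeightSeq C d) ∧
    (∀ (k : ℕ) (s : Fin k → ℕ), StrictMono s →
      (∀ r, s r ∈ Finset.Icc 1 (Module.finrank F (SumRank.Ambient F m n))) →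
      ∃ C : Submodule F (SumRank.Ambient F m n),
        SumRank.IsGreedyWeightSeq C fun r =>
          SumRank.genWeight (⊤ : Submodule F (SumRank.Ambient F m n)) (s r)) := by
  obtain ⟨D, -, hD, hMSRD⟩ := hchain
  have hconstr : ∀ (k : ℕ) (d : Fin k → ℕ), SumRank.IsAdmissible m n d →
      ∃ C : Submodule F (SumRank.Ambient F m n), SumRank.IsGenWeightSeq C d ∧
        SumRank.ChainCondition C ∧ SumRank.IsGreedyWeightSeq C d := by
    intro k d hd
    obtain ⟨C, hC, hC'⟩ := hd.exists_code hn hnm hD hMSRD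
    exact ⟨C, hC, hC', hC'.isGreedyWeightSeq hC⟩
  refine ⟨fun k d => ⟨?_, fun hd => ?_⟩, hconstr, fun k s hs hsr => ?_⟩
  · rintro ⟨C, hC⟩
    exact hC.isAdmissible hn hnm hm
  · obtain ⟨C, hC, -⟩ := hconstr k d hd
    exact ⟨C, hC⟩
  · have htop : SumRank.IsGenWeightSeq (⊤ : Submodule F (SumRank.Ambient F m n))
        (fun r : Fin (Module.finrank F (SumRank.Ambient F m n)) =>
          SumRank.genWeight (⊤ : Submodule F (SumRank.Ambient F m n)) (r + 1)) :=
      ⟨finrank_top F _, fun r => rfl⟩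
    have hs1 : ∀ r, 1 ≤ s r := fun r => (Finset.mem_Icc.1 (hsr r)).1
    have hs2 : ∀ r, s r ≤ _ := fun r => (Finset.mem_Icc.1 (hsr r)).2
    -- The positions `s r` count from one, the index type from zero. A subsequence of the admissible
    -- weight sequence of the ambient space is again admissible.
    let e : Fin k → Fin (Module.finrank F (SumRank.Ambient F m n)) := fun r =>
      ⟨s r - 1, by have := hs1 r; have := hs2 r; omega⟩
    have he : StrictMono e := fun a b hab => by
      have h1 := hs hab
      have h2 := hs1 a
      rw [Fin.lt_def]
      simp only [e]
      omega
    obtain ⟨C, -, -, hC⟩ := hconstr k _ ((htop.isAdmissible hn hnm hm).comp he)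
    refine ⟨C, ?_⟩
    convert hC using 2 with r
    simp only [Function.comp_apply, e]
    rw [Nat.sub_add_cancel (hs1 r)]
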